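/- Let $K$ be an algebraically closed field (of any characteristic), $R=K[w,x,y,z]$ and $R'=K[x,y,z]\subset R$ with the standard grading. A graded ideal $I$ is called Artinian Gorenstein if the quotient by $I$ is Artinian and its socle (the annihilator of the ideal generated by the variables) is one-dimensional over $K$; $H(R/I)_i=\dim_K (R/I)_i$ denotes the Hilbert function. Let $\mathcal D=K_{DP}[W,X,Y,Z]$ be the divided power ring, with basis the monomials $W^{[b_0]}X^{[b_1]}Y^{[b_2]}Z^{[b_3]}$, on which $R$ acts by contraction $\circ$ (so $x^i\circ X^{[b]}=X^{[b-i]}$ if $b\ge i$ and $0$ otherwise, and likewise for the other variables), and let $K_{DP}[X,Y,Z]\subset\mathcal D$ be the divided power ring on which $R'$ acts. For $F\in\mathcal D$ put $\mathrm{Ann}(F)=\{h\in R: h\circ F=0\}$, and for an ideal $I\subset R$ put $I^\perp=\{G\in\mathcal D: h\circ G=0\text{ for all }h\in I\}$; for $G\in K_{DP}[X,Y,Z]$, $\mathrm{Ann}_{R'}(G)$ is its annihilator in $R'$. A Gorenstein sequence of height $r$ is a sequence $(1,r,\ldots)$ that is the Hilbert function of an Artinian Gorenstein quotient of a polynomial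 ring in $r$ variables over $K$. Let $j\ge 4$, and let $H=(1,4,7,\ldots)$ be a sequence of nonnegative integers of socle degree $j$ (that is, $H_j\neq 0$ and $H_i=0$ for $i>j$). Let $\mathfrak V=\langle wx,wy,wz\rangle\subset R_2$, and let $\mathfrak C(H)$ be the set of graded Artinian Gorenstein ideals $I\subset R$ with $H(R/I)=H$ such that $I_2$ is carried to $\mathfrak V$ by an invertible linear change of variables. Then the following hold. (i) $\big((\mathfrak V)^{\perp}\big)_j=\langle K_{DP}[X,Y,Z]_j,\,W^{[j]}\rangle$. (ii) Let $I\in\mathfrak C(H)$ with $I_2=\mathfrak V$. Then there is $F\in\mathcal D_j$ with $I=\mathrm{Ann}(F)$, and for every such $F$ there are $G\in K_{DP}[X,Y,Z]_j$ and $\alpha\in K$ with $$F=G+\alpha W^{[j]},\qquad G\neq 0,\quad \alpha\neq 0,$$ such that, with $J_I=I\cap R'$: - $J_I=\mathrm{Ann}_{R'}(G)$, and $J_I$ is an Artinian Gorenstein ideal of $R'$ of height three; - $I=(J_I,wx,wy,wz,w^j-g)$ for some nonzero $g\in R'_j$; - $H(R/I)=H(R'/J_I)+(0,1,1,\ldots,1,0)$,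 where the ones are in degrees $1,\ldots,j-1$, and $H(R/I)=(1,4,\ldots,4,1)$, that is, $H(R/I)_{j-1}=4$ and $H(R/I)_j=1$; - $I^\perp_j=\langle F\rangle$, $I^\perp_i=0$ for $i\ge j+1$, and $I^\perp_i=(R\circ F)_i=\langle (R'\circ G)_i,\,W^{[i]}\rangle$ for $1\le i\le j-1$. (iii) $\mathfrak C(H)$ is nonempty if and only if $H-(0,1,1,\ldots,1,0)$ (ones in degrees $1,\ldots,j-1$) is a Gorenstein sequence of height three. -/

import Mathlib

open MvPolynomial

noncomputable section

namespace GorensteinNets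

/-! ### Graded Artinian Gorenstein quotients of polynomial rings -/

/-- The degree `i` part `I_i` of an ideal `I` of the polynomial ring, as a `K`-subspace. -/
def gradedPart {σ K : Type*} [Field K] (I : Ideal (MvPolynomial σ K)) (i : ℕ) :
    Submodule K (MvPolynomial σ K) :=
  I.restrictScalars K ⊓ homogeneousSubmodule σ K i

/-- The Hilbert function `H(R/I)`: its value at `i` is the dimension of the degree `i` part of
`A = R/I`, the image in `A` of the space of forms of degree `i`. -/
def hilbertFunction {σ K : Type*} [Field K] (I : Ideal (MvPolynomial σ K)) (i : ℕ) : ℕ :=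
  Module.finrank K
    ((homogeneousSubmodule σ K i).map (Ideal.Quotient.mkₐ K I).toLinearMap)

/-- The socle `(0 : M)` of `A = R/I`, where `M` is the ideal generated by the variables. -/
def socle {σ K : Type*} [Field K] (I : Ideal (MvPolynomial σ K)) :
    Submodule K (MvPolynomial σ K ⧸ I) where
  carrier := {a | ∀ m ∈ Ideal.span (Set.range (X : σ → MvPolynomial σ K)),
    Ideal.Quotient.mk I m * a = 0}
  zero_mem' := by intro m _; simp
  add_mem' := by
    intro a b ha hb m hm
    rw [mul_add, ha m hm, hb m hm, add_zero]
  smul_mem' := by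
    intro c a ha m hm
    rw [mul_smul_comm, ha m hm, smul_zero]

/-- `R/I` is a (standard) graded Artinian Gorenstein algebra: `I` is homogeneous (it contains the
homogeneous components of its elements), `R/I` is Artinian and its socle is a one-dimensional
vector space. -/
structure IsArtinianGorenstein {σ K : Type*} [Field K] (I : Ideal (MvPolynomial σ K)) : Prop where
  isHomogeneous : ∀ f ∈ I, ∀ i, homogeneousComponent i f ∈ I
  isArtinianRing : IsArtinianRing (MvPolynomial σ K ⧸ I)
  finrank_socle : Module.finrank K (socle I) = 1

/-- `H` is a Gorenstein sequence of height (embedding dimension) `r` over `K`: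
`H = (1, r, …)` is the Hilbert function of a graded Artinian Gorenstein quotient of the
polynomial ring in `r` variables. (Sequences are extended by zero beyond the socle degree.) -/
def IsGorensteinSequence (K : Type*) [Field K] (r : ℕ) (H : ℕ → ℕ) : Prop :=
  H 1 = r ∧ ∃ J : Ideal (MvPolynomial (Fin r) K),
    IsArtinianGorenstein J ∧ hilbertFunction J = H

/-! ### Divided powers and the contraction action -/

/-- The underlying vector space of the divided power ring `K_DP[X_i : i ∈ σ]`: it has as basis
the divided power monomials `X^{[b]}`, indexed by exponent vectors `b`.
Only its structure as a module over the polynomial ring is used below. -/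
abbrev DividedPower (σ K : Type*) [Field K] : Type _ := (σ →₀ ℕ) →₀ K

namespace DividedPower

variable {σ K : Type*} [Field K]

/-- The divided power monomial `X^{[b]} = ∏ i, X_i^{[b i]}`. -/
def mono (K : Type*) [Field K] (b : σ →₀ ℕ) : DividedPower σ K := Finsupp.single b 1

/-- The homogeneous part of degree `j`, spanned by the `X^{[b]}` with `∑ i, b i = j`. -/
def homogeneousPart (σ K : Type*) [Field K] (j : ℕ) : Submodule K (DividedPower σ K) :=
  Submodule.span K (mono K '' {b : σ →₀ ℕ | b.degree = j})

/-- Contraction by the monomial `x^a`: the coefficient of `X^{[c]}` in `x^a ∘ F` is the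
coefficient of `X^{[c + a]}` in `F`. -/
def contractMonomial (a : σ →₀ ℕ) : DividedPower σ K →ₗ[K] DividedPower σ K :=
  Finsupp.lcomapDomain (fun c => c + a) (add_left_injective a)

theorem contractMonomial_apply (a : σ →₀ ℕ) (F : DividedPower σ K) (c : σ →₀ ℕ) :
    contractMonomial a F c = F (c + a) := rfl

/-- `x^a ∘ X^{[b]} = X^{[b - a]}` if `a ≤ b`, and it is zero otherwise. -/
theorem contractMonomial_mono (a b : σ →₀ ℕ) [Decidable (a ≤ b)] :
    contractMonomial a (mono K b) = if a ≤ b then mono K (b - a) else 0 := by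
  classical
  ext c
  rw [contractMonomial_apply]
  split_ifs with h
  · have : b = c + a ↔ b - a = c := (tsub_eq_iff_eq_add_of_le h).symm
    simp only [mono, Finsupp.single_apply, this]
  · have : b ≠ c + a := fun e => h (e ▸ le_add_self)
    simp [mono, this]

/-- The contraction action of the polynomial ring on the divided power ring, as an algebra
homomorphism into the endomorphisms; `contract h F` is `h ∘ F`. -/
def contract : MvPolynomial σ K →ₐ[K] Module.End K (DividedPower σ K) :=
  AddMonoidAlgebra.lift K (Module.End K (DividedPower σ K)) (σ →₀ ℕ)
    { toFun := fun a => contractMonomial a.toAdd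
      map_one' := by
        ext F c
        simp [contractMonomial_apply]
      map_mul' := by
        intro a b
        refine LinearMap.ext fun F => Finsupp.ext fun c => ?_
        simp only [Module.End.mul_apply, contractMonomial_apply, toAdd_mul, add_assoc] }

theorem contract_monomial (a : σ →₀ ℕ) (r : K) (F : DividedPower σ K) :
    contract (monomial a r) F = r • contractMonomial a F := by
  have : contract (monomial a r) = r • contractMonomial (K := K) a :=
    AddMonoidAlgebra.lift_single _ _ _
  rw [this, LinearMap.smul_apply]

/-- The annihilator `Ann(F) = {h | h ∘ F = 0}`. -/
def ann (F : DividedPower σ K) : Ideal (MvPolynomial σ K) where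
  carrier := {h | contract h F = 0}
  zero_mem' := by simp
  add_mem' := by
    intro a b (ha : contract a F = 0) (hb : contract b F = 0)
    simp [ha, hb]
  smul_mem' := by
    intro c h (hh : contract h F = 0)
    simp [hh]

/-- The inverse system `I^⊥ = {G | h ∘ G = 0 for all h ∈ I}`. -/
def perp (I : Ideal (MvPolynomial σ K)) : Submodule K (DividedPower σ K) where
  carrier := {G | ∀ h ∈ I, contract h G = 0}
  zero_mem' := by intro h _; simp
  add_mem' := by
    intro a b ha hb h hh
    simp [ha h hh, hb h hh]
  smul_mem' := by
    intro c a ha h hh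
    simp [ha h hh]

/-- The cyclic module `R ∘ F = {h ∘ F | h ∈ R}`. -/
def orbit (F : DividedPower σ K) : Submodule K (DividedPower σ K) :=
  LinearMap.range (contract.toLinearMap.flip F)

end DividedPower

/-! ### The rings `R = K[w,x,y,z]` and `R' = K[x,y,z]`

The variables `w, x, y, z` have the indices `0, 1, 2, 3` in `Fin 4`, and the variables
`x, y, z` of `R'` the indices `0, 1, 2` in `Fin 3`. -/

variable (K : Type*) [Field K]

/-- The inclusion `K[x,y,z] ⊂ K[w,x,y,z]`. -/
def incl : MvPolynomial (Fin 3) K →ₐ[K] MvPolynomial (Fin 4) K := rename Fin.succ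

/-- The inclusion `K_DP[X,Y,Z] ⊂ K_DP[W,X,Y,Z]`. -/
def inclDP : DividedPower (Fin 3) K →ₗ[K] DividedPower (Fin 4) K :=
  Finsupp.lmapDomain K K (Finsupp.mapDomain Fin.succ)

/-- The divided power `W^{[i]}`. -/
def powW (i : ℕ) : DividedPower (Fin 4) K := DividedPower.mono K (Finsupp.single 0 i)

/-- The space of quadrics `𝔙 = ⟨wx, wy, wz⟩`. -/
def netV : Submodule K (MvPolynomial (Fin 4) K) :=
  Submodule.span K {X 0 * X 1, X 0 * X 2, X 0 * X 3}

/-- The ideal `(wx, wy, wz)`. -/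
def idealV : Ideal (MvPolynomial (Fin 4) K) :=
  Ideal.span {X 0 * X 1, X 0 * X 2, X 0 * X 3}

variable {K}

/-- The linear change of variables given by an invertible matrix. -/
def changeVars (g : GL (Fin 4) K) : MvPolynomial (Fin 4) K →ₐ[K] MvPolynomial (Fin 4) K :=
  aeval fun i => ∑ k, C (g.1 i k) * X k

/-- The family `ℭ(H)`: ideals `I` of `K[w,x,y,z]` such that `R/I` is graded Artinian Gorenstein
of Hilbert function `H`, and `I_2` is carried to `⟨wx, wy, wz⟩` by a linear change of
variables. -/
def familyC (K : Type*) [Field K] (H : ℕ → ℕ) : Set (Ideal (MvPolynomial (Fin 4) K)) :=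
  {I | IsArtinianGorenstein I ∧ hilbertFunction I = H ∧
    ∃ g : GL (Fin 4) K, (gradedPart I 2).map (changeVars g).toLinearMap = netV K}

/-- The sequence `(0, 1, 1, …, 1, 0)` with entries in degrees `0` to `j`, extended by zero. -/
def innerOnes (j i : ℕ) : ℕ := if 0 < i ∧ i < j then 1 else 0

end GorensteinNets

end

/-!
By Macaulay duality, a graded Artinian Gorenstein ideal of socle degree `j` is `Ann F` for a form
`F` of degree `j` in the divided power ring (`IsArtinianGorenstein.exists_eq_ann`), and conversely
the annihilator of a nonzero form is such an ideal (`isArtinianGorenstein_ann`). Its Hilbert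
function in degree `i` is `dim (R_i ∘ F)` (`hilbertFunction_ann`), and its inverse system is `R ∘ F`
(`perp_ann_inf_homogeneousPart`).

The forms of degree `j` annihilated by `wx, wy, wz` have no mixed monomials, so they are the sums
`F = G + αW^{[j]}` with `G` in `X, Y, Z` (`perp_idealV_inf_homogeneousPart`). If `Ann F` contains no
linear form, then `G` and `α` are nonzero (`exists_eq_connectedSum`). Since a form of `R` is, modulo
`(wx, wy, wz)`, a form in `x, y, z` plus a multiple of a power of `w`, one reads off
`R_i ∘ F = R'_i ∘ G ⊕ ⟨W^{[j-i]}⟩` for `0 < i < j`. This gives the Hilbert function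
(`hilbertFunction_connectedSum`) and the inverse system, and a similar computation gives the
generators (`exists_ann_connectedSum_eq`). The height of an Artinian ideal of a polynomial ring is
the number of variables (`height_of_isArtinianRing_quotient`).

For the criterion of nonemptiness, an ideal of the family is first moved by a change of variables to
one whose quadrics are `wx, wy, wz`, so that the description above applies to it; conversely, a
Gorenstein ideal `Ann G` of height three with the given Hilbert function yields `Ann (G + W^{[j]})`.
That `Ann G` contains no quadric, as `H 2 - 1 = 6`, makes the quadrics of the latter ideal
exactly `⟨wx, wy, wz⟩`.
-/

open MvPolynomial

noncomputable section

namespace GorensteinNets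

/-! ### Contraction in coordinates -/

namespace DividedPower

variable {σ K : Type*} [Field K]

theorem contract_eq_sum (h : MvPolynomial σ K) (F : DividedPower σ K) :
    contract h F = ∑ a ∈ h.support, coeff a h • contractMonomial a F := by
  conv_lhs => rw [← support_sum_monomial_coeff h]
  rw [map_sum, LinearMap.sum_apply]
  exact Finset.sum_congr rfl fun a _ => contract_monomial _ _ _

theorem contract_apply (h : MvPolynomial σ K) (F : DividedPower σ K) (c : σ →₀ ℕ) :
    contract h F c = ∑ a ∈ h.support, coeff a h * F (c + a) := by
  rw [contract_eq_sum, Finsupp.finsetSum_apply]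
  rfl

theorem contract_monomial_apply (a : σ →₀ ℕ) (r : K) (F : DividedPower σ K) (c : σ →₀ ℕ) :
    contract (monomial a r) F c = r * F (c + a) := by
  rw [contract_monomial]; rfl

theorem contract_mul (g h : MvPolynomial σ K) (F : DividedPower σ K) :
    contract (g * h) F = contract g (contract h F) := by
  rw [map_mul, Module.End.mul_apply]

theorem contract_C (r : K) (F : DividedPower σ K) : contract (C r) F = r • F := by
  ext c
  rw [← monomial_zero', contract_monomial_apply, add_zero]
  rfl

theorem contract_X_apply (i : σ) (F : DividedPower σ K) (c : σ →₀ ℕ) :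
    contract (X i) F c = F (c + Finsupp.single i 1) := by
  rw [X, contract_monomial_apply, one_mul]

/-- Each coefficient of `h ∘ F` is the constant coefficient of a contraction of `F`. -/
theorem contract_apply_eq (h : MvPolynomial σ K) (F : DividedPower σ K) (c : σ →₀ ℕ) :
    contract h F c = contract (monomial c 1 * h) F 0 := by
  rw [contract_mul, contract_monomial_apply, one_mul, zero_add]

/-- Contraction of a fixed `F`, as a linear map on the polynomial ring. -/
abbrev contractL (F : DividedPower σ K) : MvPolynomial σ K →ₗ[K] DividedPower σ K :=
  contract.toLinearMap.flip F

theorem contractL_apply (F : DividedPower σ K) (h : MvPolynomial σ K) :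
    contractL F h = contract h F := rfl

theorem mem_ann {F : DividedPower σ K} {h : MvPolynomial σ K} :
    h ∈ ann F ↔ contract h F = 0 := Iff.rfl

theorem mem_homogeneousPart {j : ℕ} {F : DividedPower σ K} :
    F ∈ homogeneousPart σ K j ↔ ∀ c, F c ≠ 0 → c.degree = j := by
  have : homogeneousPart σ K j = Finsupp.supported K K {b : σ →₀ ℕ | b.degree = j} :=
    (Finsupp.supported_eq_span_single K _).symm
  rw [this, Finsupp.mem_supported]
  exact ⟨fun h c hc => h (Finsupp.mem_support_iff.2 hc), fun h c hc =>
    h c (Finsupp.mem_support_iff.1 hc)⟩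

theorem apply_eq_zero {j : ℕ} {F : DividedPower σ K} (hF : F ∈ homogeneousPart σ K j)
    {c : σ →₀ ℕ} (hc : c.degree ≠ j) : F c = 0 := by
  by_contra h
  exact hc (mem_homogeneousPart.1 hF c h)

theorem mono_mem_homogeneousPart (c : σ →₀ ℕ) : mono K c ∈ homogeneousPart σ K c.degree :=
  Submodule.subset_span ⟨c, rfl, rfl⟩

instance [Finite σ] (j : ℕ) : FiniteDimensional K (homogeneousPart σ K j) :=
  FiniteDimensional.span_of_finite K ((Finsupp.finite_of_degree_eq j).image _)

theorem contract_apply_eq_zero {i j : ℕ} {h : MvPolynomial σ K} (hh : h.IsHomogeneous i)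
    {F : DividedPower σ K} (hF : F ∈ homogeneousPart σ K j) {c : σ →₀ ℕ}
    (hc : c.degree + i ≠ j) : contract h F c = 0 := by
  rw [contract_apply]
  refine Finset.sum_eq_zero fun a ha => ?_
  rw [apply_eq_zero hF, mul_zero]
  rw [map_add]
  have : a.degree = i := by
    by_contra h'
    exact mem_support_iff.1 ha (hh.coeff_eq_zero h')
  rwa [this]

theorem contract_mem_homogeneousPart {i j k : ℕ} {h : MvPolynomial σ K} (hh : h.IsHomogeneous i)
    {F : DividedPower σ K} (hF : F ∈ homogeneousPart σ K j) (hk : k + i = j) :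
    contract h F ∈ homogeneousPart σ K k := by
  rw [mem_homogeneousPart]
  intro c hc
  by_contra h'
  exact hc (contract_apply_eq_zero hh hF (by omega))

theorem contract_eq_zero_of_lt {i j : ℕ} {h : MvPolynomial σ K} (hh : h.IsHomogeneous i)
    {F : DividedPower σ K} (hF : F ∈ homogeneousPart σ K j) (hij : j < i) :
    contract h F = 0 := by
  ext c
  exact contract_apply_eq_zero hh hF (by omega)

theorem contract_homogeneousComponent_apply {j : ℕ} {F : DividedPower σ K}
    (hF : F ∈ homogeneousPart σ K j) (h : MvPolynomial σ K) {i : ℕ} {c : σ →₀ ℕ}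
    (hc : c.degree + i = j) :
    contract (homogeneousComponent i h) F c = contract h F c := by
  classical
  conv_rhs => rw [← sum_homogeneousComponent h, map_sum, LinearMap.sum_apply,
    Finsupp.finsetSum_apply]
  rw [Finset.sum_eq_single i]
  · intro k _ hk
    exact contract_apply_eq_zero (homogeneousComponent_isHomogeneous k h) hF (by omega)
  · intro hi
    rw [homogeneousComponent_eq_zero _ _ (by simpa using hi), map_zero]
    rfl

/-- Every linear functional on the space of divided power forms of degree `i` is contraction with
some polynomial of degree `i`. -/
theorem exists_contract_eq [Finite σ] (ψ : DividedPower σ K →ₗ[K] K) (i : ℕ) :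
    ∃ h : MvPolynomial σ K, h.IsHomogeneous i ∧
      ∀ E ∈ homogeneousPart σ K i, contract h E 0 = ψ E := by
  classical
  let s := (Finsupp.finite_of_degree_eq (σ := σ) i).toFinset
  refine ⟨∑ b ∈ s, monomial b (ψ (mono K b)), ?_, ?_⟩
  · refine IsHomogeneous.sum _ _ _ fun b hb => isHomogeneous_monomial _ ?_
    simpa [s] using hb
  · intro E hE
    refine Submodule.span_induction (p := fun E _ => contract _ E 0 = ψ E) ?_ ?_ ?_ ?_ hE
    · rintro _ ⟨b, hb, rfl⟩
      rw [map_sum, LinearMap.sum_apply, Finsupp.finsetSum_apply, Finset.sum_eq_single b]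
      · rw [contract_monomial_apply, zero_add, mono, Finsupp.single_eq_same, mul_one]
      · intro c _ hc
        rw [contract_monomial_apply, zero_add, mono, mono, Finsupp.single_eq_of_ne hc, mul_zero]
      · intro h
        exact absurd (by simpa [s] using hb) h
    · simp
    · intro x y _ _ hx hy
      rw [map_add, Finsupp.add_apply, hx, hy, map_add]
    · intro a x _ hx
      rw [map_smul, Finsupp.smul_apply, hx, map_smul]

/-- A nonzero form of degree `j` can be contracted to `1` by a form of degree `j`. -/
theorem exists_contract_eq_mono_zero {j : ℕ} {F : DividedPower σ K}
    (hF : F ∈ homogeneousPart σ K j) (h0 : F ≠ 0) :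
    ∃ h : MvPolynomial σ K, h.IsHomogeneous j ∧ contract h F = mono K 0 := by
  obtain ⟨b, hb⟩ := Finsupp.ne_iff.1 h0
  rw [Finsupp.zero_apply] at hb
  have hbj := mem_homogeneousPart.1 hF b hb
  refine ⟨monomial b (F b)⁻¹, isHomogeneous_monomial _ hbj, ?_⟩
  ext c
  rw [contract_monomial_apply]
  by_cases hc : c = 0
  · rw [hc, zero_add, inv_mul_cancel₀ hb, mono, Finsupp.single_eq_same]
  · have hne : (c + b).degree ≠ j := by
      have := (Finsupp.degree_eq_zero_iff c).not.2 hc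
      rw [map_add, hbj]
      omega
    rw [apply_eq_zero hF hne, mul_zero, mono, Finsupp.single_eq_of_ne hc]

theorem eq_smul_mono_zero {E : DividedPower σ K} (hE : E ∈ homogeneousPart σ K 0) :
    E = E 0 • mono K 0 := by
  ext c
  by_cases hc : c = 0
  · simp [hc, mono]
  · rw [apply_eq_zero hE ((Finsupp.degree_eq_zero_iff c).not.2 hc)]
    simp [mono, Finsupp.single_eq_of_ne hc]

theorem mono_zero_ne_zero : mono K (0 : σ →₀ ℕ) ≠ 0 := by
  simp [mono]

end DividedPower

open DividedPower

section InverseSystems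

variable {σ K : Type*} [Field K]

/-! ### Ideals of forms are Artinian Gorenstein -/

theorem mem_socle_iff {I : Ideal (MvPolynomial σ K)} (h : MvPolynomial σ K) :
    Ideal.Quotient.mk I h ∈ socle I ↔ ∀ i, X i * h ∈ I := by
  constructor
  · intro hh i
    have := hh (X i) (Ideal.subset_span ⟨i, rfl⟩)
    rwa [← map_mul, Ideal.Quotient.eq_zero_iff_mem] at this
  · intro hh m hm
    rw [← map_mul, Ideal.Quotient.eq_zero_iff_mem]
    refine Submodule.span_induction (p := fun m _ => m * h ∈ I) ?_ ?_ ?_ ?_ hm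
    · rintro _ ⟨i, rfl⟩
      exact hh i
    · simp
    · intro x y _ _ hx hy
      rw [add_mul]
      exact I.add_mem hx hy
    · intro a x _ hx
      rw [smul_eq_mul, mul_assoc]
      exact I.mul_mem_left _ hx

theorem ann_homogeneousComponent_mem {j : ℕ} {F : DividedPower σ K}
    (hF : F ∈ homogeneousPart σ K j) {f : MvPolynomial σ K} (hf : f ∈ ann F) (i : ℕ) :
    homogeneousComponent i f ∈ ann F := by
  rw [mem_ann] at hf ⊢
  ext c
  by_cases hc : c.degree + i = j
  · rw [contract_homogeneousComponent_apply hF f hc, hf]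
  · exact contract_apply_eq_zero (homogeneousComponent_isHomogeneous i f) hF hc

theorem mem_ann_iff_homogeneousComponent {j : ℕ} {F : DividedPower σ K}
    (hF : F ∈ homogeneousPart σ K j) {f : MvPolynomial σ K} :
    f ∈ ann F ↔ ∀ i, homogeneousComponent i f ∈ ann F := by
  refine ⟨fun hf i => ann_homogeneousComponent_mem hF hf i, fun hf => ?_⟩
  rw [← sum_homogeneousComponent f]
  exact Ideal.sum_mem _ fun i _ => hf i

/-- The space `R ∘ F` consists of elements of bounded degree. -/
theorem finite_quotient_ann [Finite σ] (F : DividedPower σ K) :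
    Module.Finite K (MvPolynomial σ K ⧸ ann F) := by
  let s : Submodule K (DividedPower σ K) :=
    Finsupp.supported K K {b | b.degree ≤ F.support.sup Finsupp.degree}
  have hs : Module.Finite K s := by
    have : s = Submodule.span K ((fun i => Finsupp.single i (1 : K)) '' _) :=
      Finsupp.supported_eq_span_single K _
    rw [this]
    exact FiniteDimensional.span_of_finite K ((Finsupp.finite_of_degree_le _).image _)
  have hmem : ∀ h, contractL F h ∈ s := by
    intro h
    rw [Finsupp.mem_supported]
    intro c hc
    rw [Finset.mem_coe, Finsupp.mem_support_iff, contractL_apply, contract_apply] at hc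
    obtain ⟨a, -, ha⟩ := Finset.exists_ne_zero_of_sum_ne_zero hc
    have h1 : c + a ∈ F.support := Finsupp.mem_support_iff.2 (right_ne_zero_of_mul ha)
    have h2 := Finset.le_sup (f := Finsupp.degree) h1
    rw [map_add] at h2
    exact le_trans (Nat.le_add_right _ _) h2
  have hle : LinearMap.range (contractL F) ≤ s := by
    rintro _ ⟨h, rfl⟩
    exact hmem h
  have hfin : Module.Finite K (LinearMap.range (contractL F)) :=
    Submodule.finiteDimensional_of_le hle
  let q := (Ideal.Quotient.mkₐ K (ann F)).toLinearMap
  have hker : LinearMap.ker (contractL F) = LinearMap.ker q := by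
    ext h
    exact (Ideal.Quotient.eq_zero_iff_mem (I := ann F)).symm
  have hq : Module.Finite K (LinearMap.range q) := Module.Finite.equiv
    ((contractL F).quotKerEquivRange.symm ≪≫ₗ Submodule.quotEquivOfEq _ _ hker ≪≫ₗ
      q.quotKerEquivRange)
  have hsurj : LinearMap.range q = ⊤ :=
    LinearMap.range_eq_top.2 (Ideal.Quotient.mkₐ_surjective K (ann F))
  rw [hsurj] at hq
  exact Module.Finite.equiv (Submodule.topEquiv (R := K) (M := MvPolynomial σ K ⧸ ann F))

/-- The socle of `R/Ann F` is carried by contraction isomorphically onto the constants: the elements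
of `R ∘ F` killed by all variables. -/
theorem isArtinianGorenstein_ann [Finite σ] {j : ℕ} {F : DividedPower σ K}
    (hF : F ∈ homogeneousPart σ K j) (h0 : F ≠ 0) : IsArtinianGorenstein (ann F) where
  isHomogeneous _ hf i := ann_homogeneousComponent_mem hF hf i
  isArtinianRing := by
    have := finite_quotient_ann F
    exact IsArtinianRing.of_finite K _
  finrank_socle := by
    obtain ⟨h, hh, h1⟩ := exists_contract_eq_mono_zero hF h0
    have hX : ∀ i, contract (X i) (mono K (0 : σ →₀ ℕ)) = 0 := by
      intro i
      ext c
      rw [contract_X_apply, mono, Finsupp.single_eq_of_ne]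
      · rfl
      · simp
    have hs : Ideal.Quotient.mk (ann F) h ∈ socle (ann F) := by
      rw [mem_socle_iff]
      intro i
      rw [mem_ann, contract_mul, h1, hX]
    rw [finrank_eq_one_iff_of_nonzero' ⟨_, hs⟩]
    · rintro ⟨w, hw⟩
      obtain ⟨f, rfl⟩ := Ideal.Quotient.mk_surjective w
      rw [mem_socle_iff] at hw
      refine ⟨contract f F 0, Subtype.ext ?_⟩
      change contract f F 0 • (Ideal.Quotient.mkₐ K (ann F)) h = Ideal.Quotient.mkₐ K (ann F) f
      rw [← map_smul]
      refine (Ideal.Quotient.eq.2 ?_)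
      rw [mem_ann, map_sub, map_smul, LinearMap.sub_apply, LinearMap.smul_apply, h1, sub_eq_zero]
      symm
      refine eq_smul_mono_zero (mem_homogeneousPart.2 fun c hc => ?_)
      by_contra hc0
      obtain ⟨i, hi⟩ := Finsupp.ne_iff.1 ((Finsupp.degree_eq_zero_iff c).not.1 hc0)
      apply hc
      have := congrArg (fun E => E (c - Finsupp.single i 1)) (hw i)
      simp only [contract_mul, contract_X_apply] at this
      rwa [tsub_add_cancel_of_le] at this
      rw [Finsupp.single_le_iff]
      exact Nat.one_le_iff_ne_zero.2 hi
    · intro h'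
      have h2 := congrArg Subtype.val h'
      rw [Submodule.coe_zero, Ideal.Quotient.eq_zero_iff_mem, mem_ann, h1] at h2
      exact mono_zero_ne_zero h2

/-! ### Macaulay duality -/

theorem finiteDimensional_homogeneousSubmodule [Finite σ] (i : ℕ) :
    FiniteDimensional K (homogeneousSubmodule σ K i) :=
  Module.Finite.iff_fg.2 (homogeneousSubmodule_fg σ K i)

theorem mem_of_hilbertFunction_eq_zero [Finite σ] {I : Ideal (MvPolynomial σ K)} {i : ℕ}
    (hI : hilbertFunction I i = 0) {h : MvPolynomial σ K} (hh : h.IsHomogeneous i) : h ∈ I := by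
  have := finiteDimensional_homogeneousSubmodule (K := K) (σ := σ) i
  have h1 := Submodule.finrank_eq_zero.1 hI
  have h2 : Ideal.Quotient.mkₐ K I h ∈
      (homogeneousSubmodule σ K i).map (Ideal.Quotient.mkₐ K I).toLinearMap :=
    Submodule.mem_map_of_mem (f := (Ideal.Quotient.mkₐ K I).toLinearMap) hh
  rw [h1, Submodule.mem_bot] at h2
  exact Ideal.Quotient.eq_zero_iff_mem.1 h2

theorem exists_notMem_of_hilbertFunction_ne_zero {I : Ideal (MvPolynomial σ K)} {i : ℕ}
    (hI : hilbertFunction I i ≠ 0) : ∃ h : MvPolynomial σ K, h.IsHomogeneous i ∧ h ∉ I := by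
  by_contra! hall
  apply hI
  have : (homogeneousSubmodule σ K i).map (Ideal.Quotient.mkₐ K I).toLinearMap = ⊥ := by
    rw [eq_bot_iff]
    rintro _ ⟨h, hh, rfl⟩
    exact Ideal.Quotient.eq_zero_iff_mem.2 (hall h hh)
  rw [hilbertFunction, this, finrank_bot]

/-- **Macaulay's theorem**: a graded Artinian Gorenstein ideal of socle degree `j` is the
annihilator of a divided power form of degree `j`, the form whose coefficients are the values of
a generator of the dual of the socle. -/
theorem IsArtinianGorenstein.exists_eq_ann [Finite σ] {I : Ideal (MvPolynomial σ K)}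
    (hI : IsArtinianGorenstein I) {j : ℕ} (hj : hilbertFunction I j ≠ 0)
    (hlt : ∀ i, j < i → hilbertFunction I i = 0) :
    ∃ F ∈ homogeneousPart σ K j, I = ann F := by
  classical
  have hbig : ∀ {i : ℕ} {h : MvPolynomial σ K}, h.IsHomogeneous i → j < i → h ∈ I :=
    fun hh hi => mem_of_hilbertFunction_eq_zero (hlt _ hi) hh
  have hsoc : ∀ {h : MvPolynomial σ K}, h.IsHomogeneous j → Ideal.Quotient.mk I h ∈ socle I := by
    intro h hh
    rw [mem_socle_iff]
    exact fun i => hbig ((isHomogeneous_X K i).mul hh) (by omega)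
  obtain ⟨s, hs, hsI⟩ := exists_notMem_of_hilbertFunction_ne_zero hj
  have hs0 : Ideal.Quotient.mk I s ≠ 0 := fun h => hsI (Ideal.Quotient.eq_zero_iff_mem.1 h)
  have hspan : ∀ h : MvPolynomial σ K, Ideal.Quotient.mk I h ∈ socle I →
      ∃ c : K, h - c • s ∈ I := by
    intro h hh
    have h1 := (finrank_eq_one_iff_of_nonzero' (⟨_, hsoc hs⟩ : socle I)
      (fun h => hs0 (congrArg Subtype.val h))).1 hI.finrank_socle ⟨_, hh⟩
    obtain ⟨c, hc⟩ := h1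
    have h2 : c • (Ideal.Quotient.mkₐ K I) s = Ideal.Quotient.mkₐ K I h := congrArg Subtype.val hc
    rw [← map_smul] at h2
    exact ⟨c, Ideal.Quotient.eq.1 h2.symm⟩
  obtain ⟨l, hl⟩ := Module.Projective.exists_dual_eq_one K hs0
  have hls : l (Ideal.Quotient.mkₐ K I s) = 1 := hl
  let F : DividedPower σ K := Finsupp.onFinset (Finsupp.finite_of_degree_eq (σ := σ) j).toFinset
    (fun b => if b.degree = j then l (Ideal.Quotient.mkₐ K I (monomial b 1)) else 0)
    (by
      intro b hb
      rw [Set.Finite.mem_toFinset]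
      by_contra h
      exact hb (if_neg h))
  have hFb : ∀ b, F b = if b.degree = j then l (Ideal.Quotient.mkₐ K I (monomial b 1)) else 0 :=
    fun _ => rfl
  have hF : F ∈ homogeneousPart σ K j := by
    rw [mem_homogeneousPart]
    intro c hc
    by_contra h
    exact hc (if_neg h)
  have hF0 : ∀ {h : MvPolynomial σ K}, h.IsHomogeneous j →
      contract h F 0 = l (Ideal.Quotient.mkₐ K I h) := by
    intro h hh
    conv_rhs => rw [← support_sum_monomial_coeff h, map_sum, map_sum]
    rw [contract_apply]
    refine Finset.sum_congr rfl fun a ha => ?_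
    have ha' : a.degree = j := by
      by_contra h'
      exact mem_support_iff.1 ha (hh.coeff_eq_zero h')
    rw [zero_add, hFb, if_pos ha', ← smul_eq_mul, ← map_smul, ← map_smul, smul_monomial,
      smul_eq_mul, mul_one]
  have hle : I ≤ ann F := by
    intro f hf
    rw [mem_ann_iff_homogeneousComponent hF]
    intro i
    have hfi := hI.isHomogeneous f hf i
    have hi := homogeneousComponent_isHomogeneous i f
    rw [mem_ann]
    ext c
    by_cases hc : c.degree + i = j
    · rw [contract_apply_eq, hF0 (hc ▸ (isHomogeneous_monomial 1 rfl).mul hi)]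
      rw [show Ideal.Quotient.mkₐ K I (monomial c 1 * homogeneousComponent i f) = 0 from
        Ideal.Quotient.eq_zero_iff_mem.2 (I.mul_mem_left _ hfi), map_zero]
      rfl
    · exact contract_apply_eq_zero hi hF hc
  -- descending induction on the degree, written as `i + n = j + 1`
  have key : ∀ (n i : ℕ), j < i + n → ∀ h : MvPolynomial σ K, h.IsHomogeneous i →
      h ∈ ann F → h ∈ I := by
    intro n
    induction n with
    | zero => exact fun i hi h hh _ => hbig hh (by omega)
    | succ n ih =>
      intro i hi h hh hann
      have hsocle : Ideal.Quotient.mk I h ∈ socle I := by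
        rw [mem_socle_iff]
        exact fun k => ih (1 + i) (by omega) _ ((isHomogeneous_X K k).mul hh)
          (Ideal.mul_mem_left _ _ hann)
      obtain ⟨c, hc⟩ := hspan h hsocle
      by_cases hij : i = j
      · subst hij
        have h1 : l (Ideal.Quotient.mkₐ K I h) = 0 := by
          rw [← hF0 hh, mem_ann.1 hann]
          rfl
        have h2 : Ideal.Quotient.mkₐ K I h = c • Ideal.Quotient.mkₐ K I s := by
          rw [← map_smul]
          exact Ideal.Quotient.eq.2 hc
        rw [h2, map_smul, hls, smul_eq_mul, mul_one] at h1
        rwa [h1, zero_smul, sub_zero] at hc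
      · have h1 := hI.isHomogeneous _ hc i
        rwa [map_sub, map_smul, homogeneousComponent_of_mem hh, homogeneousComponent_of_mem hs,
          if_pos rfl, if_neg hij, smul_zero, sub_zero] at h1
  refine ⟨F, hF, le_antisymm hle fun f hf => ?_⟩
  rw [← sum_homogeneousComponent f]
  exact Ideal.sum_mem _ fun i _ => key (j + 1) i (by omega) _
    (homogeneousComponent_isHomogeneous i f) (ann_homogeneousComponent_mem hF hf i)

/-! ### Hilbert functions and inverse systems of forms -/

/-- The dimension of the image of `p` depends only on the kernel of the map on `p`. -/
theorem finrank_map_eq_finrank_map {V A B : Type*} [AddCommGroup V] [Module K V]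
    [AddCommGroup A] [Module K A] [AddCommGroup B] [Module K B] (p : Submodule K V)
    (f : V →ₗ[K] A) (g : V →ₗ[K] B) (hfg : ∀ x ∈ p, f x = 0 ↔ g x = 0) :
    Module.finrank K (p.map f) = Module.finrank K (p.map g) := by
  have hker : LinearMap.ker (f.domRestrict p) = LinearMap.ker (g.domRestrict p) := by
    ext x
    exact hfg x x.2
  rw [← LinearMap.range_domRestrict, ← LinearMap.range_domRestrict]
  exact ((f.domRestrict p).quotKerEquivRange.symm ≪≫ₗ Submodule.quotEquivOfEq _ _ hker ≪≫ₗ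
    (g.domRestrict p).quotKerEquivRange).finrank_eq

/-- `(R/Ann F)_i` is isomorphic to `R_i ∘ F`. -/
theorem hilbertFunction_ann (F : DividedPower σ K) (i : ℕ) :
    hilbertFunction (ann F) i =
      Module.finrank K ((homogeneousSubmodule σ K i).map (contractL F)) :=
  finrank_map_eq_finrank_map _ _ _ fun _ _ => Ideal.Quotient.eq_zero_iff_mem

theorem map_contractL_of_lt {i j : ℕ} {F : DividedPower σ K} (hF : F ∈ homogeneousPart σ K j)
    (hij : j < i) : (homogeneousSubmodule σ K i).map (contractL F) = ⊥ := by
  rw [eq_bot_iff]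
  rintro _ ⟨h, hh, rfl⟩
  exact contract_eq_zero_of_lt hh hF hij

theorem map_contractL_zero (F : DividedPower σ K) :
    (homogeneousSubmodule σ K 0).map (contractL F) = Submodule.span K {F} := by
  ext E
  rw [Submodule.mem_span_singleton]
  constructor
  · rintro ⟨h, hh, rfl⟩
    rw [SetLike.mem_coe, homogeneousSubmodule_zero, Submodule.mem_one] at hh
    obtain ⟨c, rfl⟩ := hh
    exact ⟨c, (contract_C c F).symm⟩
  · rintro ⟨c, rfl⟩
    exact ⟨C c, isHomogeneous_C _ _, contract_C c F⟩

theorem map_contractL_self {j : ℕ} {F : DividedPower σ K} (hF : F ∈ homogeneousPart σ K j)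
    (h0 : F ≠ 0) :
    (homogeneousSubmodule σ K j).map (contractL F) = Submodule.span K {mono K 0} := by
  apply le_antisymm
  · rintro _ ⟨h, hh, rfl⟩
    exact Submodule.mem_span_singleton.2
      ⟨_, (eq_smul_mono_zero (contract_mem_homogeneousPart hh hF (zero_add j))).symm⟩
  · rw [Submodule.span_singleton_le_iff_mem]
    obtain ⟨h, hh, h1⟩ := exists_contract_eq_mono_zero hF h0
    exact ⟨h, hh, h1⟩

theorem hilbertFunction_ann_of_lt {i j : ℕ} {F : DividedPower σ K}
    (hF : F ∈ homogeneousPart σ K j) (hij : j < i) : hilbertFunction (ann F) i = 0 := by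
  rw [hilbertFunction_ann, map_contractL_of_lt hF hij, finrank_bot]

theorem hilbertFunction_ann_zero {F : DividedPower σ K} (h0 : F ≠ 0) :
    hilbertFunction (ann F) 0 = 1 := by
  rw [hilbertFunction_ann, map_contractL_zero, finrank_span_singleton h0]

theorem hilbertFunction_ann_self {j : ℕ} {F : DividedPower σ K}
    (hF : F ∈ homogeneousPart σ K j) (h0 : F ≠ 0) : hilbertFunction (ann F) j = 1 := by
  rw [hilbertFunction_ann, map_contractL_self hF h0, finrank_span_singleton mono_zero_ne_zero]

theorem orbit_inf_homogeneousPart {i j k : ℕ} {F : DividedPower σ K}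
    (hF : F ∈ homogeneousPart σ K j) (hk : k + i = j) :
    orbit F ⊓ homogeneousPart σ K k = (homogeneousSubmodule σ K i).map (contractL F) := by
  apply le_antisymm
  · rintro _ ⟨⟨h, rfl⟩, hE⟩
    refine ⟨homogeneousComponent i h, homogeneousComponent_isHomogeneous i h, ?_⟩
    change contract _ F = contract h F
    ext c
    by_cases hc : c.degree = k
    · exact contract_homogeneousComponent_apply hF h (by omega)
    · rw [contract_apply_eq_zero (homogeneousComponent_isHomogeneous i h) hF (by omega)]
      exact (apply_eq_zero hE hc).symm
  · rintro _ ⟨h, hh, rfl⟩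
    exact ⟨⟨h, rfl⟩, contract_mem_homogeneousPart hh hF hk⟩

/-- The double annihilator property: a form of degree `k` outside `R ∘ F` is separated from
`(R ∘ F)_k` by a functional, which is contraction by a form annihilating `F`. -/
theorem perp_ann_inf_homogeneousPart [Finite σ] {j : ℕ} {F : DividedPower σ K}
    (hF : F ∈ homogeneousPart σ K j) (k : ℕ) :
    perp (ann F) ⊓ homogeneousPart σ K k = orbit F ⊓ homogeneousPart σ K k := by
  apply le_antisymm
  · rintro G ⟨hG, hGk⟩
    refine ⟨?_, hGk⟩
    by_contra hG'
    have hG2 : G ∉ orbit F ⊓ homogeneousPart σ K k := fun h => hG' h.1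
    obtain ⟨ψ, hψ, hker⟩ := Submodule.exists_le_ker_of_notMem hG2
    obtain ⟨h, hh, hrep⟩ := exists_contract_eq ψ k
    apply hψ
    rw [← hrep G hGk]
    have : h ∈ ann F := by
      rw [mem_ann]
      ext c
      by_cases hc : c.degree + k = j
      · have hmem : contract (monomial c 1) F ∈ homogeneousPart σ K k :=
          contract_mem_homogeneousPart (isHomogeneous_monomial 1 rfl) hF (by omega)
        rw [contract_apply_eq, mul_comm, contract_mul, hrep _ hmem]
        exact hker ⟨⟨_, rfl⟩, hmem⟩
      · exact contract_apply_eq_zero hh hF hc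
    rw [hG h this]
    rfl
  · rintro _ ⟨⟨h, rfl⟩, hE⟩
    refine ⟨?_, hE⟩
    intro f hf
    change contract f (contract h F) = 0
    rw [← contract_mul, mul_comm, contract_mul, mem_ann.1 hf, map_zero]

theorem perp_inf_homogeneousPart_eq_bot {I : Ideal (MvPolynomial σ K)} {i : ℕ}
    (hI : ∀ h : MvPolynomial σ K, h.IsHomogeneous i → h ∈ I) :
    perp I ⊓ homogeneousPart σ K i = ⊥ := by
  rw [eq_bot_iff]
  rintro G ⟨hG, hGi⟩
  rw [Submodule.mem_bot]
  ext b
  by_cases hb : b.degree = i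
  · have := hG _ (hI (monomial b 1) (isHomogeneous_monomial _ hb))
    have h0 := congrArg (fun E => E 0) this
    simp only [contract_monomial_apply, one_mul, zero_add] at h0
    exact h0
  · exact apply_eq_zero hGi hb

/-- Symmetry of the Hilbert function, in the only degree where it is needed: if `Ann F` contains no
linear form, then every divided power linear form lies in `R ∘ F`. -/
theorem hilbertFunction_ann_sub_one [Finite σ] {j : ℕ} {F : DividedPower σ K}
    (hF : F ∈ homogeneousPart σ K j) (hj : 1 ≤ j)
    (h1 : ∀ h ∈ ann F, h.IsHomogeneous 1 → h = 0) :
    hilbertFunction (ann F) (j - 1) = Module.finrank K (homogeneousPart σ K 1) := by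
  rw [hilbertFunction_ann, ← orbit_inf_homogeneousPart hF (show 1 + (j - 1) = j by omega),
    ← perp_ann_inf_homogeneousPart hF 1]
  have hle : homogeneousPart σ K 1 ≤ perp (ann F) := ?_
  · rw [inf_eq_right.2 hle]
  intro G hG h hh
  ext c
  rw [contract_apply_eq, ← contract_homogeneousComponent_apply hG _ (i := 1) (by simp),
    h1 _ (ann_homogeneousComponent_mem hF (Ideal.mul_mem_left _ _ hh) 1)
      (homogeneousComponent_isHomogeneous _ _), map_zero contract]
  rfl

theorem finrank_homogeneousPart [Finite σ] (i : ℕ) :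
    Module.finrank K (homogeneousPart σ K i) = Nat.card {b : σ →₀ ℕ // b.degree = i} := by
  have e : Module.finrank K (homogeneousPart σ K i) =
      Module.finrank K (Finsupp.supported K K {b : σ →₀ ℕ | b.degree = i}) := by
    congr 2
    all_goals rw [Finsupp.supported_eq_span_single]; rfl
  have := (Finsupp.finite_of_degree_eq (σ := σ) i).fintype
  rw [e, (Finsupp.supportedEquivFinsupp {b : σ →₀ ℕ | b.degree = i}).finrank_eq,
    Module.finrank_finsupp_self, ← Nat.card_eq_fintype_card]
  rfl

theorem finrank_homogeneousSubmodule [Finite σ] (i : ℕ) :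
    Module.finrank K (homogeneousSubmodule σ K i) = Nat.card {b : σ →₀ ℕ // b.degree = i} := by
  have := (Finsupp.finite_of_degree_eq (σ := σ) i).fintype
  rw [homogeneousSubmodule_eq_finsupp_supported, (AddMonoidAlgebra.supportedEquivFinsupp
    {b : σ →₀ ℕ | b.degree = i}).finrank_eq, Module.finrank_finsupp_self,
    ← Nat.card_eq_fintype_card]
  rfl

theorem card_degree_eq (n i : ℕ) :
    Nat.card {b : Fin n →₀ ℕ // b.degree = i} = n.multichoose i := by
  classical
  have h := Finset.card_finsuppAntidiag_nat_eq_multichoose (s := (Finset.univ : Finset (Fin n))) i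
  rw [Finset.card_univ, Fintype.card_fin] at h
  rw [← h]
  refine Nat.subtype_card _ fun b => ?_
  rw [Finset.mem_finsuppAntidiag, Finsupp.degree_eq_sum]
  simp

/-- If `R/I` has the same dimension as `R` in degree `i`, then `I` has no elements there. -/
theorem eq_zero_of_hilbertFunction_eq [Finite σ] {I : Ideal (MvPolynomial σ K)} {i : ℕ}
    (hI : hilbertFunction I i = Module.finrank K (homogeneousSubmodule σ K i))
    {h : MvPolynomial σ K} (hh : h.IsHomogeneous i) (hhI : h ∈ I) : h = 0 := by
  have := finiteDimensional_homogeneousSubmodule (K := K) (σ := σ) i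
  let f := (Ideal.Quotient.mkₐ K I).toLinearMap.domRestrict (homogeneousSubmodule σ K i)
  have h1 := LinearMap.finrank_range_add_finrank_ker f
  have h2 : LinearMap.range f =
      (homogeneousSubmodule σ K i).map (Ideal.Quotient.mkₐ K I).toLinearMap :=
    LinearMap.range_domRestrict _ _
  rw [h2] at h1
  unfold hilbertFunction at hI
  have h3 : LinearMap.ker f = ⊥ := Submodule.finrank_eq_zero.1 (by omega)
  have h4 : (⟨h, hh⟩ : homogeneousSubmodule σ K i) ∈ LinearMap.ker f :=
    Ideal.Quotient.eq_zero_iff_mem.2 hhI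
  rw [h3, Submodule.mem_bot] at h4
  exact congrArg Subtype.val h4

end InverseSystems

section Coordinates

variable {K : Type*} [Field K]

/-! ### The inverse system of `(wx, wy, wz)` -/

/-- An exponent vector is an exponent vector in `x, y, z`, or a power of `w`, or is divisible by
one of `wx, wy, wz`. -/
theorem exponent_cases (b : Fin 4 →₀ ℕ) :
    (∃ c : Fin 3 →₀ ℕ, b = c.mapDomain Fin.succ) ∨
      (∃ k, 0 < k ∧ b = Finsupp.single 0 k) ∨
      ∃ (s : Fin 3) (d : Fin 4 →₀ ℕ), b = d + Finsupp.single s.succ 1 + Finsupp.single 0 1 := by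
  by_cases h0 : b 0 = 0
  · refine Or.inl ⟨b.comapDomain Fin.succ (Fin.succ_injective 3).injOn, ?_⟩
    rw [Finsupp.mapDomain_comapDomain _ (Fin.succ_injective 3)]
    intro i hi
    refine Fin.cases (fun hi => absurd h0 (by simpa using hi)) (fun s _ => ⟨s, rfl⟩) i hi
  · by_cases hs : ∃ s : Fin 3, b s.succ ≠ 0
    · obtain ⟨s, hs⟩ := hs
      refine Or.inr (Or.inr ⟨s, b - (Finsupp.single s.succ 1 + Finsupp.single 0 1), ?_⟩)
      rw [add_assoc, tsub_add_cancel_of_le]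
      intro i
      refine Fin.cases ?_ (fun t => ?_) i
      · simpa using Nat.one_le_iff_ne_zero.2 h0
      · by_cases hst : t = s
        · subst hst
          simpa using Nat.one_le_iff_ne_zero.2 hs
        · simp [Ne.symm hst]
    · push Not at hs
      refine Or.inr (Or.inl ⟨b 0, Nat.pos_of_ne_zero h0, ?_⟩)
      ext i
      refine Fin.cases (by simp) (fun t => ?_) i
      rw [hs t, Finsupp.single_eq_of_ne (Fin.succ_ne_zero t)]

theorem mapDomain_succ_zero (c : Fin 3 →₀ ℕ) : c.mapDomain Fin.succ (0 : Fin 4) = 0 :=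
  Finsupp.mapDomain_of_notMem_range _ _ (by simp)

theorem mapDomain_succ_injective :
    Function.Injective (Finsupp.mapDomain Fin.succ : (Fin 3 →₀ ℕ) → (Fin 4 →₀ ℕ)) :=
  Finsupp.mapDomain_injective (Fin.succ_injective 3)

theorem inclDP_apply (G : DividedPower (Fin 3) K) (c : Fin 3 →₀ ℕ) :
    inclDP K G (c.mapDomain Fin.succ) = G c :=
  Finsupp.mapDomain_apply mapDomain_succ_injective G c

theorem inclDP_apply_of_ne {b : Fin 4 →₀ ℕ} (hb : b 0 ≠ 0) (G : DividedPower (Fin 3) K) :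
    inclDP K G b = 0 := by
  refine Finsupp.mapDomain_of_notMem_range _ _ ?_
  rintro ⟨c, rfl⟩
  exact hb (mapDomain_succ_zero c)

theorem inclDP_injective : Function.Injective (inclDP K) :=
  Finsupp.mapDomain_injective mapDomain_succ_injective

theorem inclDP_mono (c : Fin 3 →₀ ℕ) : inclDP K (mono K c) = mono K (c.mapDomain Fin.succ) :=
  Finsupp.mapDomain_single

theorem inclDP_mem {j : ℕ} {G : DividedPower (Fin 3) K} (hG : G ∈ homogeneousPart (Fin 3) K j) :
    inclDP K G ∈ homogeneousPart (Fin 4) K j := by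
  rw [mem_homogeneousPart] at hG ⊢
  intro b hb
  by_cases h0 : b 0 = 0
  · rcases exponent_cases b with ⟨c, rfl⟩ | ⟨k, hk, rfl⟩ | ⟨s, d, rfl⟩
    · rw [inclDP_apply] at hb
      rw [Finsupp.degree_mapDomain, hG c hb]
    · simp at h0; omega
    · simp at h0
  · exact absurd (inclDP_apply_of_ne h0 G) hb

theorem powW_mem (j : ℕ) : powW K j ∈ homogeneousPart (Fin 4) K j := by
  have := mono_mem_homogeneousPart (K := K) (Finsupp.single (0 : Fin 4) j)
  rwa [Finsupp.degree_single] at this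

theorem powW_apply_self (j : ℕ) : powW K j (Finsupp.single 0 j) = 1 := Finsupp.single_eq_same

theorem powW_apply_of_ne {j : ℕ} {b : Fin 4 →₀ ℕ} (hb : b ≠ Finsupp.single 0 j) :
    powW K j b = 0 := Finsupp.single_eq_of_ne hb

theorem powW_ne_zero (j : ℕ) : powW K j ≠ 0 := by simp [powW, mono]

theorem incl_monomial (c : Fin 3 →₀ ℕ) (r : K) :
    incl K (monomial c r) = monomial (c.mapDomain Fin.succ) r :=
  rename_monomial _ _ _

theorem contract_incl_inclDP (h : MvPolynomial (Fin 3) K) (G : DividedPower (Fin 3) K) :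
    contract (incl K h) (inclDP K G) = inclDP K (contract h G) := by
  induction h using MvPolynomial.induction_on' with
  | monomial a r =>
    rw [incl_monomial]
    ext b
    rw [contract_monomial_apply]
    by_cases h0 : b 0 = 0
    · rcases exponent_cases b with ⟨c, rfl⟩ | ⟨k, hk, rfl⟩ | ⟨s, d, rfl⟩
      · rw [← Finsupp.mapDomain_add, inclDP_apply, inclDP_apply, contract_monomial_apply]
      · simp at h0; omega
      · simp at h0
    · rw [inclDP_apply_of_ne h0, inclDP_apply_of_ne, mul_zero]
      rw [Finsupp.add_apply]
      omega
  | add p q hp hq => simp only [map_add, LinearMap.add_apply, hp, hq]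

theorem contract_incl_powW (h : MvPolynomial (Fin 3) K) (j : ℕ) :
    contract (incl K h) (powW K j) = coeff 0 h • powW K j := by
  induction h using MvPolynomial.induction_on' with
  | monomial a r =>
    rw [incl_monomial]
    by_cases ha : a = 0
    · subst ha
      rw [Finsupp.mapDomain_zero, monomial_zero', contract_C, coeff_monomial, if_pos rfl]
    · rw [coeff_monomial, if_neg ha, zero_smul]
      ext b
      rw [contract_monomial_apply, powW_apply_of_ne, mul_zero]
      · rfl
      · intro hb
        apply ha
        ext s
        have := DFunLike.congr_fun hb s.succ
        rw [Finsupp.add_apply, Finsupp.mapDomain_apply (Fin.succ_injective 3),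
          Finsupp.single_eq_of_ne (Fin.succ_ne_zero s)] at this
        simp only [Finsupp.coe_zero, Pi.zero_apply]
        omega
  | add p q hp hq => simp only [map_add, LinearMap.add_apply, hp, hq, coeff_add, add_smul]

theorem contract_pow_inclDP {k : ℕ} (hk : 0 < k) (G : DividedPower (Fin 3) K) :
    contract (X 0 ^ k) (inclDP K G) = 0 := by
  ext b
  rw [X_pow_eq_monomial, contract_monomial_apply, inclDP_apply_of_ne, mul_zero]
  · rfl
  · simp; omega

theorem contract_pow_powW {k j : ℕ} (hk : k ≤ j) :
    contract (X 0 ^ k) (powW K j) = powW K (j - k) := by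
  classical
  rw [X_pow_eq_monomial, contract_monomial, one_smul, powW, contractMonomial_mono, if_pos, powW,
    ← Finsupp.single_tsub]
  simpa using hk

theorem monomial_mem_idealV (s : Fin 3) (d : Fin 4 →₀ ℕ) (r : K) :
    monomial (d + Finsupp.single s.succ 1 + Finsupp.single 0 1) r ∈ idealV K := by
  have h1 : monomial (d + Finsupp.single s.succ 1 + Finsupp.single 0 1) r =
      monomial d r * (X 0 * X s.succ) := by
    rw [mul_comm (X 0), ← mul_assoc, X, X, monomial_mul, monomial_mul, mul_one, mul_one]
  rw [h1]
  refine Ideal.mul_mem_left _ _ (Ideal.subset_span ?_)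
  fin_cases s <;> simp

theorem idealV_le_iff {I : Ideal (MvPolynomial (Fin 4) K)} :
    idealV K ≤ I ↔ ∀ s : Fin 3, X 0 * X s.succ ∈ I := by
  rw [idealV, Ideal.span_le]
  constructor
  · intro h s
    apply h
    fin_cases s <;> simp
  · rintro h _ (rfl | rfl | rfl)
    exacts [h 0, h 1, h 2]

theorem mem_perp_idealV {F : DividedPower (Fin 4) K} :
    F ∈ perp (idealV K) ↔ idealV K ≤ ann F := Iff.rfl

theorem idealV_le_ann_inclDP (G : DividedPower (Fin 3) K) : idealV K ≤ ann (inclDP K G) := by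
  rw [idealV_le_iff]
  intro s
  rw [mem_ann, mul_comm, contract_mul, ← pow_one (X 0), contract_pow_inclDP one_pos, map_zero]

theorem idealV_le_ann_powW (j : ℕ) : idealV K ≤ ann (powW K j) := by
  rw [idealV_le_iff]
  intro s
  have : (X s.succ : MvPolynomial (Fin 4) K) = incl K (X s) := (rename_X _ _).symm
  rw [mem_ann, contract_mul, this, contract_incl_powW]
  simp

theorem perp_idealV_inf_homogeneousPart {j : ℕ} (hj : 0 < j) :
    perp (idealV K) ⊓ homogeneousPart (Fin 4) K j =
      (homogeneousPart (Fin 3) K j).map (inclDP K) ⊔ Submodule.span K {powW K j} := by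
  apply le_antisymm
  · rintro F ⟨hF, hFj⟩
    rw [Submodule.mem_sup]
    let G : DividedPower (Fin 3) K :=
      F.comapDomain (Finsupp.mapDomain Fin.succ) mapDomain_succ_injective.injOn
    have hGc : ∀ c, G c = F (c.mapDomain Fin.succ) := fun _ => rfl
    refine ⟨inclDP K G, ⟨G, ?_, rfl⟩, F (Finsupp.single 0 j) • powW K j,
      Submodule.mem_span_singleton.2 ⟨_, rfl⟩, ?_⟩
    · refine mem_homogeneousPart.2 fun c hc => ?_
      rw [← Finsupp.degree_mapDomain Fin.succ c]
      exact mem_homogeneousPart.1 hFj _ hc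
    · ext b
      rw [Finsupp.add_apply, Finsupp.smul_apply, smul_eq_mul]
      rcases exponent_cases b with ⟨c, rfl⟩ | ⟨k, hk, rfl⟩ | ⟨s, d, rfl⟩
      · rw [inclDP_apply, hGc, powW_apply_of_ne, mul_zero, add_zero]
        intro h
        have := DFunLike.congr_fun h 0
        rw [mapDomain_succ_zero, Finsupp.single_eq_same] at this
        omega
      · rw [inclDP_apply_of_ne (by simpa using hk.ne'), zero_add]
        by_cases hkj : k = j
        · subst hkj
          rw [powW_apply_self, mul_one]
        · rw [powW_apply_of_ne, mul_zero, apply_eq_zero hFj]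
          · simpa using hkj
          · intro h
            exact hkj (Finsupp.single_injective 0 h)
      · rw [inclDP_apply_of_ne (by simp), powW_apply_of_ne, mul_zero, zero_add]
        · have h1 := congrArg (fun E => E 0) (hF _ (monomial_mem_idealV s d 1))
          simp only [contract_monomial_apply, one_mul, zero_add] at h1
          exact h1.symm
        · intro h
          have := DFunLike.congr_fun h s.succ
          simp at this
  · rw [sup_le_iff, Submodule.span_singleton_le_iff_mem]
    refine ⟨?_, idealV_le_ann_powW j, powW_mem j⟩
    rintro _ ⟨G, hG, rfl⟩
    exact ⟨idealV_le_ann_inclDP G, inclDP_mem hG⟩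

/-! ### Connected sums of a ternary form and a power of `W` -/

section ConnectedSum

variable {j : ℕ} {G : DividedPower (Fin 3) K} {α : K}

theorem inclDP_add_powW_mem (hG : G ∈ homogeneousPart (Fin 3) K j) :
    inclDP K G + α • powW K j ∈ homogeneousPart (Fin 4) K j :=
  Submodule.add_mem _ (inclDP_mem hG) (Submodule.smul_mem _ _ (powW_mem j))

theorem idealV_le_ann_connectedSum : idealV K ≤ ann (inclDP K G + α • powW K j) := by
  intro h hh
  rw [mem_ann, map_add, map_smul, idealV_le_ann_inclDP G hh, idealV_le_ann_powW j hh, smul_zero,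
    add_zero]

theorem contract_incl_connectedSum (h : MvPolynomial (Fin 3) K) :
    contract (incl K h) (inclDP K G + α • powW K j) =
      inclDP K (contract h G) + (coeff 0 h * α) • powW K j := by
  rw [map_add, map_smul, contract_incl_inclDP, contract_incl_powW, smul_smul, mul_comm]

theorem contract_pow_connectedSum {k : ℕ} (hk : 0 < k) (hkj : k ≤ j) :
    contract (X 0 ^ k) (inclDP K G + α • powW K j) = α • powW K (j - k) := by
  rw [map_add, map_smul, contract_pow_inclDP hk, contract_pow_powW hkj, zero_add]

/-- The spaces `K_DP[X,Y,Z]` and `⟨W^{[i]}⟩` are independent when `i > 0`. -/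
theorem inclDP_eq_zero_of_add_eq_zero {i : ℕ} (hi : 0 < i) {E : DividedPower (Fin 3) K} {c : K}
    (h : inclDP K E + c • powW K i = 0) : E = 0 ∧ c = 0 := by
  have hc : c = 0 := by
    have := DFunLike.congr_fun h (Finsupp.single 0 i)
    rwa [Finsupp.add_apply, inclDP_apply_of_ne (by simpa using hi.ne'), zero_add,
      Finsupp.smul_apply, powW_apply_self, smul_eq_mul, mul_one] at this
  refine ⟨inclDP_injective ?_, hc⟩
  rw [map_zero]
  rwa [hc, zero_smul, add_zero] at h

theorem connectedSum_ne_zero (hj : 0 < j) (hG0 : G ≠ 0) : inclDP K G + α • powW K j ≠ 0 :=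
  fun h => hG0 (inclDP_eq_zero_of_add_eq_zero hj h).1

/-- The constant term of a polynomial annihilating a nonzero form vanishes. -/
theorem coeff_zero_of_mem_ann {σ : Type*} {F : DividedPower σ K}
    (hF : F ∈ homogeneousPart σ K j) (h0 : F ≠ 0) {h : MvPolynomial σ K} (hh : h ∈ ann F) :
    coeff 0 h = 0 := by
  have h1 := ann_homogeneousComponent_mem hF hh 0
  rw [homogeneousComponent_zero, mem_ann, contract_C] at h1
  exact (smul_eq_zero.1 h1).resolve_right h0

/-- Polynomials in `x, y, z` without constant term annihilate `W^{[j]}`, and those annihilating `G`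
or `F` have no constant term. -/
theorem comap_ann_connectedSum (hj : 0 < j) (hG : G ∈ homogeneousPart (Fin 3) K j)
    (hG0 : G ≠ 0) : (ann (inclDP K G + α • powW K j)).comap (incl K) = ann G := by
  ext h
  rw [Ideal.mem_comap, mem_ann, mem_ann, contract_incl_connectedSum]
  constructor
  · exact fun h' => (inclDP_eq_zero_of_add_eq_zero hj h').1
  · intro h'
    rw [h', coeff_zero_of_mem_ann hG hG0 h', zero_mul, zero_smul, map_zero, add_zero]

/-- Modulo `(wx, wy, wz)`, a form is the sum of a form in `x, y, z` and a
multiple of a power of `w`. -/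
theorem exists_sub_mem_idealV {i : ℕ} {h : MvPolynomial (Fin 4) K}
    (hh : h.IsHomogeneous i) :
    ∃ p : MvPolynomial (Fin 3) K, p.IsHomogeneous i ∧
      ∃ c : K, h - (incl K p + C c * X 0 ^ i) ∈ idealV K := by
  have hmem : h ∈ homogeneousSubmodule (Fin 4) K i := hh
  rw [homogeneousSubmodule_eq_finsupp_supported, AddMonoidAlgebra.supported_eq_span_single] at hmem
  refine Submodule.span_induction (p := fun h _ => ∃ p : MvPolynomial (Fin 3) K,
    p.IsHomogeneous i ∧ ∃ c : K, h - (incl K p + C c * X 0 ^ i) ∈ idealV K) ?_ ?_ ?_ ?_ hmem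
  · rintro _ ⟨b, hb, rfl⟩
    change ∃ p : MvPolynomial (Fin 3) K, p.IsHomogeneous i ∧ ∃ c : K,
      monomial b 1 - (incl K p + C c * X 0 ^ i) ∈ idealV K
    rcases exponent_cases b with ⟨c, rfl⟩ | ⟨k, hk, rfl⟩ | ⟨s, d, rfl⟩
    · refine ⟨monomial c 1, isHomogeneous_monomial _ ?_, 0, ?_⟩
      · rwa [← Finsupp.degree_mapDomain Fin.succ c]
      · rw [incl_monomial, map_zero, zero_mul, add_zero, sub_self]
        exact zero_mem _
    · refine ⟨0, isHomogeneous_zero _ _ _, 1, ?_⟩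
      have : k = i := by simpa using hb
      rw [← X_pow_eq_monomial, map_zero, map_one, one_mul, zero_add, this, sub_self]
      exact zero_mem _
    · refine ⟨0, isHomogeneous_zero _ _ _, 0, ?_⟩
      rw [map_zero, map_zero, zero_mul, zero_add, sub_zero]
      exact monomial_mem_idealV s d 1
  · refine ⟨0, isHomogeneous_zero _ _ _, 0, ?_⟩
    simp
  · rintro x y _ _ ⟨p, hp, c, hc⟩ ⟨q, hq, d, hd⟩
    refine ⟨p + q, hp.add hq, c + d, ?_⟩
    convert Ideal.add_mem _ hc hd using 1
    rw [map_add, map_add]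
    ring
  · rintro a x _ ⟨p, hp, c, hc⟩
    refine ⟨C a * p, hp.C_mul a, a * c, ?_⟩
    convert Ideal.mul_mem_left _ (C a) hc using 1
    rw [map_mul, smul_eq_C_mul, map_mul, show incl K (C a) = C a from rename_C _ _]
    ring

theorem contract_eq_of_sub_mem_idealV {h : MvPolynomial (Fin 4) K} {p : MvPolynomial (Fin 3) K}
    {i : ℕ} {c : K} (hi : 0 < i) (hp : p.IsHomogeneous i)
    (hc : h - (incl K p + C c * X 0 ^ i) ∈ idealV K) (hij : i ≤ j) :
    contract h (inclDP K G + α • powW K j) =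
      inclDP K (contract p G) + (c * α) • powW K (j - i) := by
  have h1 := idealV_le_ann_connectedSum (G := G) (α := α) (j := j) hc
  rw [mem_ann, map_sub, LinearMap.sub_apply, sub_eq_zero] at h1
  have hp0 : coeff 0 p = 0 := hp.coeff_eq_zero (by simpa using hi.ne)
  rw [h1, map_add contract, LinearMap.add_apply, contract_incl_connectedSum, contract_mul,
    contract_C, contract_pow_connectedSum hi hij, hp0, zero_mul, zero_smul, add_zero, smul_smul]

/-- In degrees `0 < i ≤ j` the space `R_i ∘ F` splits into `R'_i ∘ G` and the line of
`W^{[j-i]}`. -/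
theorem map_contractL_connectedSum {i : ℕ} (hi : 0 < i) (hij : i ≤ j) (hα : α ≠ 0) :
    (homogeneousSubmodule (Fin 4) K i).map (contractL (inclDP K G + α • powW K j)) =
      ((homogeneousSubmodule (Fin 3) K i).map (contractL G)).map (inclDP K) ⊔
        Submodule.span K {powW K (j - i)} := by
  apply le_antisymm
  · rintro _ ⟨h, hh, rfl⟩
    obtain ⟨p, hp, c, hc⟩ := exists_sub_mem_idealV hh
    rw [contractL_apply, contract_eq_of_sub_mem_idealV hi hp hc hij]
    exact Submodule.add_mem_sup ⟨_, ⟨p, hp, rfl⟩, rfl⟩ (Submodule.mem_span_singleton.2 ⟨_, rfl⟩)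
  · rw [sup_le_iff, Submodule.span_singleton_le_iff_mem]
    constructor
    · rintro _ ⟨_, ⟨p, hp, rfl⟩, rfl⟩
      refine ⟨incl K p, IsHomogeneous.rename_isHomogeneous hp, ?_⟩
      have hp0 : coeff 0 p = 0 := IsHomogeneous.coeff_eq_zero hp (by simpa using hi.ne)
      rw [contractL_apply, contract_incl_connectedSum, hp0, zero_mul, zero_smul, add_zero]
      rfl
    · refine ⟨C α⁻¹ * X 0 ^ i, (isHomogeneous_X_pow _ _).C_mul _, ?_⟩
      rw [contractL_apply, contract_mul, contract_C, contract_pow_connectedSum hi hij,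
        inv_smul_smul₀ hα]

theorem hilbertFunction_connectedSum (hj : 0 < j) (hG : G ∈ homogeneousPart (Fin 3) K j)
    (hG0 : G ≠ 0) (hα : α ≠ 0) (i : ℕ) :
    hilbertFunction (ann (inclDP K G + α • powW K j)) i =
      hilbertFunction (ann G) i + innerOnes j i := by
  have hF := inclDP_add_powW_mem (α := α) hG
  have hF0 := connectedSum_ne_zero (α := α) hj hG0
  unfold innerOnes
  rcases Nat.eq_zero_or_pos i with rfl | hi
  · rw [hilbertFunction_ann_zero hF0, hilbertFunction_ann_zero hG0, if_neg (by omega)]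
  rcases lt_trichotomy i j with hij | rfl | hij
  · rw [if_pos ⟨hi, hij⟩, hilbertFunction_ann, map_contractL_connectedSum hi hij.le hα,
      hilbertFunction_ann]
    set U := (homogeneousSubmodule (Fin 3) K i).map (contractL G)
    have := finiteDimensional_homogeneousSubmodule (K := K) (σ := Fin 3) i
    have h1 := Submodule.finrank_sup_add_finrank_inf_eq (U.map (inclDP K))
      (Submodule.span K {powW K (j - i)})
    have h2 : U.map (inclDP K) ⊓ Submodule.span K {powW K (j - i)} = ⊥ := by
      rw [eq_bot_iff]
      rintro E ⟨⟨E', -, rfl⟩, hE⟩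
      obtain ⟨c, hc⟩ := Submodule.mem_span_singleton.1 hE
      have h3 : inclDP K E' + (-c) • powW K (j - i) = 0 := by
        rw [← hc, neg_smul, add_neg_cancel]
      rw [(inclDP_eq_zero_of_add_eq_zero (by omega) h3).1, map_zero]
      exact zero_mem _
    rw [h2, finrank_bot, add_zero, finrank_span_singleton (powW_ne_zero _),
      ← (Submodule.equivMapOfInjective (inclDP K) inclDP_injective U).finrank_eq] at h1
    exact h1
  · rw [hilbertFunction_ann_self hF hF0, hilbertFunction_ann_self hG hG0, if_neg (by omega)]
  · rw [hilbertFunction_ann_of_lt hF hij, hilbertFunction_ann_of_lt hG hij, if_neg (by omega)]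

theorem orbit_connectedSum_inf (hG : G ∈ homogeneousPart (Fin 3) K j) (hα : α ≠ 0) {i : ℕ}
    (hij : i < j) :
    orbit (inclDP K G + α • powW K j) ⊓ homogeneousPart (Fin 4) K i =
      (orbit G ⊓ homogeneousPart (Fin 3) K i).map (inclDP K) ⊔ Submodule.span K {powW K i} := by
  have h1 : i + (j - i) = j := by omega
  rw [orbit_inf_homogeneousPart (inclDP_add_powW_mem hG) h1, orbit_inf_homogeneousPart hG h1,
    map_contractL_connectedSum (by omega) (by omega) hα, show j - (j - i) = i by omega]

theorem X_mul_incl_mem_idealV {p : MvPolynomial (Fin 3) K} {i : ℕ} (hi : 0 < i)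
    (hp : p.IsHomogeneous i) : X 0 * incl K p ∈ idealV K := by
  have hsum : incl K p = ∑ c ∈ p.support, incl K (monomial c (coeff c p)) := by
    rw [← map_sum, support_sum_monomial_coeff]
  rw [hsum, Finset.mul_sum]
  refine Ideal.sum_mem _ fun c hc => ?_
  have hdeg : c.degree = i := by
    by_contra h'
    exact mem_support_iff.1 hc (hp.coeff_eq_zero h')
  obtain ⟨s, hs⟩ : ∃ s, c s ≠ 0 := by
    by_contra! h
    have : c = 0 := by ext s; exact h s
    rw [this, map_zero] at hdeg
    omega
  have h1 : c = (c - Finsupp.single s 1) + Finsupp.single s 1 := by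
    rw [tsub_add_cancel_of_le]
    exact Finsupp.single_le_iff.2 (Nat.one_le_iff_ne_zero.2 hs)
  rw [incl_monomial, X, monomial_mul, one_mul, h1, Finsupp.mapDomain_add,
    Finsupp.mapDomain_single, add_comm]
  exact monomial_mem_idealV _ _ _

/-- The generators of `Ann F`, for `F = G + αW^{[j]}`. A form `g` with `g ∘ G = α` gives the
relation `w^j - g`, which eliminates `w^j`; higher powers of `w` then lie in the ideal because
`w * g` is in `(wx, wy, wz)`, and lower ones are detected by their action on `W^{[j]}`. -/
theorem exists_ann_connectedSum_eq (hj : 0 < j) (hG : G ∈ homogeneousPart (Fin 3) K j)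
    (hG0 : G ≠ 0) (hα : α ≠ 0) :
    ∃ g ∈ homogeneousSubmodule (Fin 3) K j, g ≠ 0 ∧
      ann (inclDP K G + α • powW K j) =
        (ann G).map (incl K) ⊔ idealV K ⊔ Ideal.span {X 0 ^ j - incl K g} := by
  set F := inclDP K G + α • powW K j with hFdef
  have hF : F ∈ homogeneousPart (Fin 4) K j := inclDP_add_powW_mem hG
  have hF0 : F ≠ 0 := connectedSum_ne_zero hj hG0
  have hcomap : (ann F).comap (incl K) = ann G := comap_ann_connectedSum hj hG hG0
  obtain ⟨g, hg, hgG⟩ := exists_contract_eq_mono_zero hG hG0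
  have hcg : (C α * g).IsHomogeneous j := hg.C_mul α
  have hcgG : contract (C α * g) G = α • mono K 0 := by rw [contract_mul, hgG, contract_C]
  have hrel : X 0 ^ j - incl K (C α * g) ∈ ann F := by
    have h0 : coeff 0 (C α * g) = 0 := hcg.coeff_eq_zero (by simpa using hj.ne)
    rw [mem_ann, map_sub, LinearMap.sub_apply, contract_pow_connectedSum hj le_rfl,
      contract_incl_connectedSum, hcgG, h0, zero_mul, zero_smul, add_zero, map_smul, inclDP_mono,
      Finsupp.mapDomain_zero, Nat.sub_self, powW, Finsupp.single_zero, sub_self]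
  have hle : ∀ {p}, p ∈ ann G → incl K p ∈ (ann G).map (incl K) ⊔ idealV K ⊔
      Ideal.span {X 0 ^ j - incl K (C α * g)} := fun hp =>
    Ideal.mem_sup_left (Ideal.mem_sup_left (Ideal.mem_map_of_mem _ hp))
  have hleV : ∀ {p}, p ∈ idealV K → p ∈ (ann G).map (incl K) ⊔ idealV K ⊔
      Ideal.span {X 0 ^ j - incl K (C α * g)} := fun hp =>
    Ideal.mem_sup_left (Ideal.mem_sup_right hp)
  have hleR : ∀ p, p * (X 0 ^ j - incl K (C α * g)) ∈ (ann G).map (incl K) ⊔ idealV K ⊔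
      Ideal.span {X 0 ^ j - incl K (C α * g)} := fun p =>
    Ideal.mem_sup_right (Ideal.mul_mem_left _ _ (Ideal.mem_span_singleton_self _))
  refine ⟨C α * g, hcg, ?_, le_antisymm ?_ ?_⟩
  · intro h
    rw [h, map_zero, LinearMap.zero_apply] at hcgG
    exact smul_ne_zero hα mono_zero_ne_zero hcgG.symm
  · intro f hf
    rw [← sum_homogeneousComponent f]
    refine Ideal.sum_mem _ fun i _ => ?_
    have hfi := ann_homogeneousComponent_mem hF hf i
    have hi := homogeneousComponent_isHomogeneous i f
    generalize homogeneousComponent i f = h at hfi hi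
    rcases Nat.eq_zero_or_pos i with rfl | hipos
    · have h0 := coeff_zero_of_mem_ann hF hF0 hfi
      rw [← mem_homogeneousSubmodule, homogeneousSubmodule_zero, Submodule.mem_one] at hi
      obtain ⟨c, rfl⟩ := hi
      rw [show (algebraMap K (MvPolynomial (Fin 4) K)) c = C c from rfl, coeff_C,
        if_pos rfl] at h0
      rw [h0, map_zero]
      exact zero_mem _
    obtain ⟨p, hp, c, hc⟩ := exists_sub_mem_idealV hi
    have hsplit : h = (h - (incl K p + C c * X 0 ^ i)) + (incl K p + C c * X 0 ^ i) := by ring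
    rw [hsplit]
    refine Ideal.add_mem _ (hleV hc) ?_
    rcases lt_or_ge i j with hij | hij
    · have h1 : contract h F = _ := contract_eq_of_sub_mem_idealV hipos hp hc hij.le
      rw [mem_ann.1 hfi] at h1
      obtain ⟨h2, h3⟩ := inclDP_eq_zero_of_add_eq_zero (by omega) h1.symm
      rw [(mul_eq_zero.1 h3).resolve_right hα, map_zero, zero_mul, add_zero]
      exact hle h2
    · have h4 : incl K p + C c * X 0 ^ i ∈ ann F := by
        have := (ann F).sub_mem hfi (idealV_le_ann_connectedSum hc)
        rwa [sub_sub_cancel] at this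
      rcases hij.eq_or_lt with rfl | hij
      · have h5 : incl K p + C c * X 0 ^ j = incl K (p + C c * (C α * g)) +
            C c * (X 0 ^ j - incl K (C α * g)) := by
          rw [map_add, map_mul (incl K) (C c), show incl K (C c) = C c from rename_C _ _]
          ring
        rw [h5] at h4 ⊢
        refine Ideal.add_mem _ (hle ?_) (hleR _)
        rw [← hcomap, Ideal.mem_comap]
        have := (ann F).sub_mem h4 ((ann F).mul_mem_left (C c) hrel)
        rwa [add_sub_cancel_right] at this
      · have h5 : incl K p + C c * X 0 ^ i = incl K p + (C c * X 0 ^ (i - j) *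
            (X 0 ^ j - incl K (C α * g)) + C c * X 0 ^ (i - j - 1) *
            (X 0 * incl K (C α * g))) := by
          obtain ⟨m, rfl⟩ : ∃ m, i = j + m + 1 := ⟨i - j - 1, by omega⟩
          rw [show j + m + 1 - j = m + 1 by omega, Nat.add_sub_cancel]
          ring
        rw [h5]
        refine Ideal.add_mem _ (hle (contract_eq_zero_of_lt hp hG hij))
          (Ideal.add_mem _ (hleR _) (hleV (Ideal.mul_mem_left _ _ ?_)))
        exact X_mul_incl_mem_idealV hj hcg
  · rw [sup_le_iff, sup_le_iff, Ideal.map_le_iff_le_comap, hcomap, Ideal.span_singleton_le_iff_mem]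
    exact ⟨⟨le_rfl, idealV_le_ann_connectedSum⟩, hrel⟩

end ConnectedSum

end Coordinates

/-! ### Changes of coordinates -/

section Transport

variable {σ K : Type*} [Field K] {e : MvPolynomial σ K ≃ₐ[K] MvPolynomial σ K}

theorem map_homogeneousSubmodule_of_graded
    (he : ∀ i p, IsHomogeneous p i → IsHomogeneous (e p) i)
    (he' : ∀ i p, IsHomogeneous p i → IsHomogeneous (e.symm p) i) (i : ℕ) :
    (homogeneousSubmodule σ K i).map e.toLinearMap = homogeneousSubmodule σ K i := by
  apply le_antisymm
  · rintro _ ⟨p, hp, rfl⟩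
    exact he i p hp
  · intro p hp
    exact ⟨e.symm p, he' i p hp, e.apply_symm_apply p⟩

/-- An automorphism preserving degrees commutes with taking homogeneous components. -/
theorem homogeneousComponent_graded (he : ∀ i p, IsHomogeneous p i → IsHomogeneous (e p) i)
    (f : MvPolynomial σ K) (i : ℕ) :
    homogeneousComponent i (e f) = e (homogeneousComponent i f) := by
  conv_lhs => rw [← sum_homogeneousComponent f, map_sum, map_sum]
  rw [Finset.sum_eq_single i]
  · rw [homogeneousComponent_of_mem (he i _ (homogeneousComponent_isHomogeneous i f)), if_pos rfl]
  · intro k _ hk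
    rw [homogeneousComponent_of_mem (he k _ (homogeneousComponent_isHomogeneous k f)),
      if_neg hk.symm]
  · intro hi
    rw [homogeneousComponent_eq_zero i f (by simpa using hi), map_zero, map_zero]

theorem hilbertFunction_comap_symm
    (he' : ∀ i p, IsHomogeneous p i → IsHomogeneous (e.symm p) i)
    (he : ∀ i p, IsHomogeneous p i → IsHomogeneous (e p) i)
    (I : Ideal (MvPolynomial σ K)) : hilbertFunction (I.comap e.symm) = hilbertFunction I := by
  funext i
  have h1 : hilbertFunction I i = Module.finrank K ((homogeneousSubmodule σ K i).map
      ((Ideal.Quotient.mkₐ K I).toLinearMap ∘ₗ e.symm.toLinearMap)) := by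
    rw [Submodule.map_comp, map_homogeneousSubmodule_of_graded (e := e.symm) he' he]
    rfl
  rw [h1]
  refine finrank_map_eq_finrank_map _ _ _ fun x _ => ?_
  exact (Ideal.Quotient.eq_zero_iff_mem (I := I.comap e.symm)).trans
    (Ideal.Quotient.eq_zero_iff_mem (I := I) (a := e.symm x)).symm

theorem gradedPart_comap_symm
    (he : ∀ i p, IsHomogeneous p i → IsHomogeneous (e p) i)
    (he' : ∀ i p, IsHomogeneous p i → IsHomogeneous (e.symm p) i)
    (I : Ideal (MvPolynomial σ K)) (i : ℕ) :
    gradedPart (I.comap e.symm) i = (gradedPart I i).map e.toLinearMap := by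
  ext p
  constructor
  · rintro ⟨hp, hpi⟩
    exact ⟨e.symm p, ⟨hp, he' i p hpi⟩, e.apply_symm_apply p⟩
  · rintro ⟨q, ⟨hq, hqi⟩, rfl⟩
    refine ⟨?_, he i q hqi⟩
    change e.symm (e q) ∈ I
    rwa [e.symm_apply_apply]

theorem span_X_graded (he : ∀ i p, IsHomogeneous p i → IsHomogeneous (e p) i)
    {m : MvPolynomial σ K} (hm : m ∈ Ideal.span (Set.range (X : σ → MvPolynomial σ K))) :
    e m ∈ Ideal.span (Set.range (X : σ → MvPolynomial σ K)) := by
  have hlin : ∀ p : MvPolynomial σ K, p.IsHomogeneous 1 →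
      p ∈ Ideal.span (Set.range (X : σ → MvPolynomial σ K)) := by
    intro p hp
    rw [← mem_homogeneousSubmodule, homogeneousSubmodule_one_eq_span_X] at hp
    exact Submodule.span_le_restrictScalars K (MvPolynomial σ K) _ hp
  have hle : Ideal.span (Set.range (X : σ → MvPolynomial σ K)) ≤
      (Ideal.span (Set.range (X : σ → MvPolynomial σ K))).comap e := by
    rw [Ideal.span_le]
    rintro _ ⟨i, rfl⟩
    exact hlin _ (he 1 _ (isHomogeneous_X K i))
  exact hle hm

theorem IsArtinianGorenstein.comap_symm {I : Ideal (MvPolynomial σ K)}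
    (hI : IsArtinianGorenstein I) (he : ∀ i p, IsHomogeneous p i → IsHomogeneous (e p) i)
    (he' : ∀ i p, IsHomogeneous p i → IsHomogeneous (e.symm p) i) :
    IsArtinianGorenstein (I.comap e.symm) := by
  have hI' : I = (I.comap e.symm).map (e.symm : MvPolynomial σ K →+* MvPolynomial σ K) :=
    (Ideal.map_comap_of_surjective (e.symm : MvPolynomial σ K →+* MvPolynomial σ K)
      e.symm.surjective I).symm
  let Q : (MvPolynomial σ K ⧸ I.comap e.symm) ≃ₐ[K] (MvPolynomial σ K ⧸ I) :=
    Ideal.quotientEquivAlg _ _ e.symm hI'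
  have hQ : ∀ p, Q (Ideal.Quotient.mk _ p) = Ideal.Quotient.mk I (e.symm p) := fun _ => rfl
  refine ⟨fun f hf i => ?_, ?_, ?_⟩
  · rw [Ideal.mem_comap, ← homogeneousComponent_graded he']
    exact hI.isHomogeneous _ hf i
  · have := hI.isArtinianRing
    exact Function.Surjective.isArtinianRing (f := Q.symm) Q.symm.surjective
  · have hmap : (socle (I.comap e.symm)).map (Q.toLinearEquiv : _ →ₗ[K] _) = socle I := by
      apply le_antisymm
      · rintro _ ⟨a, ha, rfl⟩ m hm
        have h1 := ha (e m) (span_X_graded he hm)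
        have h2 := congrArg Q h1
        rw [map_mul, hQ, e.symm_apply_apply, map_zero] at h2
        exact h2
      · intro a ha
        refine ⟨Q.symm a, fun m hm => ?_, Q.apply_symm_apply a⟩
        apply Q.injective
        rw [map_mul, hQ, Q.apply_symm_apply, map_zero]
        exact ha _ (span_X_graded (e := e.symm) he' hm)
    rw [← hI.finrank_socle, ← hmap]
    exact (Q.toLinearEquiv.finrank_map_eq _).symm

end Transport

section ChangeVars

variable {K : Type*} [Field K]

theorem changeVars_X (g : GL (Fin 4) K) (i : Fin 4) :
    changeVars g (X i) = ∑ k, C (g.1 i k) * X k := aeval_X _ _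

theorem changeVars_comp (g h : GL (Fin 4) K) :
    (changeVars g).comp (changeVars h) = changeVars (h * g) := by
  apply algHom_ext
  intro i
  have hC : ∀ c : K, changeVars g (C c) = C c := fun c => (changeVars g).commutes c
  rw [AlgHom.comp_apply, changeVars_X, changeVars_X, map_sum]
  simp only [map_mul, hC, changeVars_X, Finset.mul_sum, Units.val_mul, Matrix.mul_apply, map_sum,
    Finset.sum_mul]
  rw [Finset.sum_comm]
  simp only [mul_assoc]

theorem changeVars_one : changeVars (1 : GL (Fin 4) K) = AlgHom.id K _ := by
  apply algHom_ext
  intro i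
  rw [changeVars_X]
  simp [Matrix.one_apply]

/-- A linear change of variables as an automorphism of the polynomial ring. -/
def changeVarsEquiv (g : GL (Fin 4) K) : MvPolynomial (Fin 4) K ≃ₐ[K] MvPolynomial (Fin 4) K :=
  AlgEquiv.ofAlgHom (changeVars g) (changeVars g⁻¹)
    (by rw [changeVars_comp, inv_mul_cancel, changeVars_one])
    (by rw [changeVars_comp, mul_inv_cancel, changeVars_one])

theorem isHomogeneous_changeVars (g : GL (Fin 4) K) (i : ℕ) (p : MvPolynomial (Fin 4) K)
    (hp : p.IsHomogeneous i) : (changeVars g p).IsHomogeneous i := by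
  rw [← one_mul i]
  exact hp.aeval _ fun _ => IsHomogeneous.sum _ _ _ fun _ _ => isHomogeneous_C_mul_X _ _

/-- Up to a change of variables, the degree two part of an ideal in `ℭ(H)` is `⟨wx, wy, wz⟩`. -/
theorem exists_mem_familyC_gradedPart_eq {H : ℕ → ℕ} (hH : (familyC K H).Nonempty) :
    ∃ I ∈ familyC K H, gradedPart I 2 = netV K := by
  obtain ⟨I, hI, hIH, g, hg⟩ := hH
  have he : ∀ i p, IsHomogeneous p i → IsHomogeneous (changeVarsEquiv g p) i :=
    isHomogeneous_changeVars g
  have he' : ∀ i p, IsHomogeneous p i → IsHomogeneous ((changeVarsEquiv g).symm p) i :=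
    isHomogeneous_changeVars g⁻¹
  have h2 : gradedPart (I.comap (changeVarsEquiv g).symm) 2 = netV K := by
    rw [gradedPart_comap_symm he he']
    exact hg
  refine ⟨I.comap (changeVarsEquiv g).symm, ⟨hI.comap_symm he he', ?_, 1, ?_⟩, h2⟩
  · rw [hilbertFunction_comap_symm he' he, hIH]
  · rw [changeVars_one, h2]
    exact Submodule.map_id _

end ChangeVars

/-! ### The height of an Artinian ideal -/

section Height

variable {K : Type*} [Field K]

/-- Translation by a point of affine space. -/
def translate {σ : Type*} (a : σ → K) : MvPolynomial σ K ≃ₐ[K] MvPolynomial σ K :=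
  AlgEquiv.ofAlgHom (aeval fun i => X i + C (a i)) (aeval fun i => X i - C (a i))
    (by
      apply algHom_ext
      intro i
      simp [← algebraMap_eq])
    (by
      apply algHom_ext
      intro i
      simp [← algebraMap_eq])

theorem comap_translate {σ : Type*} (a : σ → K) :
    (vanishingIdeal K {(0 : σ → K)}).comap (translate a : MvPolynomial σ K →+* MvPolynomial σ K) =
      vanishingIdeal K {a} := by
  ext p
  rw [Ideal.mem_comap, mem_vanishingIdeal_singleton_iff, mem_vanishingIdeal_singleton_iff]
  have : (aeval (0 : σ → K)).comp (translate a).toAlgHom = aeval a := by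
    apply algHom_ext
    intro i
    simp [translate]
  rw [← this]
  rfl

/-- By the Nullstellensatz, translations permute the maximal ideals transitively, so all of them
have the same height, which is the Krull dimension. -/
theorem height_of_isMaximal [IsAlgClosed K] {n : ℕ} (m : Ideal (MvPolynomial (Fin n) K))
    (hm : m.IsMaximal) : m.height = n := by
  have hall : ∀ m : Ideal (MvPolynomial (Fin n) K), m.IsMaximal →
      m.height = (vanishingIdeal K {(0 : Fin n → K)}).height := by
    intro m hm
    obtain ⟨a, rfl⟩ := isMaximal_iff_eq_vanishingIdeal_singleton.1 hm
    rw [← comap_translate]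
    exact (translate a).toRingEquiv.height_comap _
  have h1 := Ideal.sup_isMaximal_height_eq_ringKrullDim (R := MvPolynomial (Fin n) K)
  have h2 : (⨆ I : Ideal (MvPolynomial (Fin n) K), ⨆ _ : I.IsMaximal, I.height) = m.height := by
    apply le_antisymm
    · refine iSup₂_le fun I hI => ?_
      rw [hall I hI, hall m hm]
    · exact le_iSup₂ (f := fun (I : Ideal (MvPolynomial (Fin n) K)) (_ : I.IsMaximal) =>
        I.height) m hm
  rw [h2, ringKrullDim_of_isNoetherianRing, ringKrullDim_eq_zero_of_field, zero_add,
    Nat.card_eq_fintype_card, Fintype.card_fin] at h1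
  exact_mod_cast h1

/-- The primes containing `J` are all maximal. -/
theorem height_of_isArtinianRing_quotient [IsAlgClosed K] {n : ℕ}
    {J : Ideal (MvPolynomial (Fin n) K)} (hJ : IsArtinianRing (MvPolynomial (Fin n) K ⧸ J))
    (htop : J ≠ ⊤) : J.height = n := by
  have hprime : ∀ P ∈ J.minimalPrimes, P.height = n := by
    rintro P ⟨⟨hP, hJP⟩, -⟩
    apply height_of_isMaximal
    have hker : RingHom.ker (Ideal.Quotient.mk J) ≤ P := by rwa [Ideal.mk_ker]
    have h1 : (P.map (Ideal.Quotient.mk J)).IsPrime :=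
      Ideal.map_isPrime_of_surjective Ideal.Quotient.mk_surjective hker
    have h2 : (P.map (Ideal.Quotient.mk J)).IsMaximal := IsArtinianRing.isMaximal_of_isPrime _
    have h3 := Ideal.comap_isMaximal_of_surjective (Ideal.Quotient.mk J)
      Ideal.Quotient.mk_surjective (K := P.map (Ideal.Quotient.mk J))
    rwa [Ideal.comap_map_of_surjective _ Ideal.Quotient.mk_surjective, ← RingHom.ker_eq_comap_bot,
      sup_eq_left.2 hker] at h3
  obtain ⟨P, hP⟩ := Ideal.nonempty_minimalPrimes htop
  rw [Ideal.height_eq_inf_minimalPrimes]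
  apply le_antisymm
  · exact (iInf₂_le P hP).trans (hprime P hP).le
  · exact le_iInf₂ fun Q hQ => (hprime Q hQ).ge

end Height

/-! ### The family `ℭ(H)` -/

section Family

variable {K : Type*} [Field K]

theorem contract_mono_apply_zero {σ : Type*} (h : MvPolynomial σ K) (b : σ →₀ ℕ) :
    contract h (mono K b) 0 = coeff b h := by
  classical
  rw [contract_apply, Finset.sum_eq_single b]
  · rw [zero_add, mono, Finsupp.single_eq_same, mul_one]
  · intro c _ hc
    rw [zero_add, mono, Finsupp.single_eq_of_ne hc, mul_zero]
  · intro hb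
    rw [notMem_support_iff.1 hb, zero_mul]

theorem X_mul_X_mem_netV (s : Fin 3) : X 0 * X s.succ ∈ netV K := by
  apply Submodule.subset_span
  fin_cases s <;> simp

theorem netV_le_gradedPart {I : Ideal (MvPolynomial (Fin 4) K)} (hI : idealV K ≤ I) :
    netV K ≤ gradedPart I 2 := by
  rw [netV, Submodule.span_le]
  have h : ∀ s : Fin 3, X 0 * X s.succ ∈ gradedPart I 2 := fun s =>
    ⟨idealV_le_iff.1 hI s, (isHomogeneous_X K 0).mul (isHomogeneous_X K s.succ)⟩
  rintro _ (rfl | rfl | rfl)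
  exacts [h 0, h 1, h 2]

/-- No pure monomial in `x, y, z` and no power of `w` occurs in an element of `(wx, wy, wz)`, since
the ideal annihilates the dual monomials. -/
theorem mem_netV_of_mem_idealV {h : MvPolynomial (Fin 4) K} (hh : h.IsHomogeneous 2)
    (hV : h ∈ idealV K) : h ∈ netV K := by
  rw [← support_sum_monomial_coeff h]
  refine Submodule.sum_mem _ fun b hb => ?_
  have hb0 := mem_support_iff.1 hb
  rw [← contract_mono_apply_zero] at hb0
  have hdeg : b.degree = 2 := by
    by_contra h'
    exact mem_support_iff.1 hb (hh.coeff_eq_zero h')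
  rcases exponent_cases b with ⟨c, rfl⟩ | ⟨k, hk, rfl⟩ | ⟨s, d, rfl⟩
  · rw [← inclDP_mono, mem_ann.1 (idealV_le_ann_inclDP _ hV)] at hb0
    exact absurd rfl hb0
  · rw [← powW, mem_ann.1 (idealV_le_ann_powW k hV)] at hb0
    exact absurd rfl hb0
  · have hd : d = 0 := by
      rw [map_add, map_add, Finsupp.degree_single, Finsupp.degree_single] at hdeg
      exact (Finsupp.degree_eq_zero_iff d).1 (by omega)
    subst hd
    have : ∀ r : K, monomial (0 + Finsupp.single s.succ 1 + Finsupp.single 0 1) r =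
        r • (X 0 * X s.succ : MvPolynomial (Fin 4) K) := by
      intro r
      rw [mul_comm, X, X, monomial_mul, smul_monomial, zero_add]
      simp
    rw [this]
    exact Submodule.smul_mem _ _ (X_mul_X_mem_netV s)

/-- If `Ann G` contains no quadric, the quadrics in `Ann F` are those of `(wx, wy, wz)`: as `2 < j`,
the square `w^2` does not act as any quadric in `x, y, z`. -/
theorem gradedPart_two_ann_connectedSum {j : ℕ} (hj : 2 < j) {G : DividedPower (Fin 3) K}
    {α : K} (hα : α ≠ 0) (hG : ∀ p ∈ ann G, p.IsHomogeneous 2 → p = 0) :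
    gradedPart (ann (inclDP K G + α • powW K j)) 2 = netV K := by
  refine le_antisymm ?_ (netV_le_gradedPart idealV_le_ann_connectedSum)
  rintro h ⟨hann, hh⟩
  obtain ⟨p, hp, c, hc⟩ := exists_sub_mem_idealV hh
  have h1 := contract_eq_of_sub_mem_idealV (G := G) (α := α) two_pos hp hc hj.le
  rw [mem_ann.1 hann] at h1
  obtain ⟨h2, h3⟩ := inclDP_eq_zero_of_add_eq_zero (by omega) h1.symm
  rw [hG p h2 hp, (mul_eq_zero.1 h3).resolve_right hα, map_zero, map_zero, zero_mul, add_zero,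
    sub_zero] at hc
  exact mem_netV_of_mem_idealV hh hc

theorem idealV_le_of_gradedPart {I : Ideal (MvPolynomial (Fin 4) K)}
    (hI : gradedPart I 2 = netV K) : idealV K ≤ I := by
  rw [idealV_le_iff]
  intro s
  have := X_mul_X_mem_netV (K := K) s
  rw [← hI] at this
  exact this.1

/-- If `Ann F` has degree two part `⟨wx, wy, wz⟩` and contains no linear form, then `F` is a
connected sum of a nonzero ternary form and a nonzero multiple of `W^{[j]}`. -/
theorem exists_eq_connectedSum {j : ℕ} (hj : 0 < j) {F : DividedPower (Fin 4) K}
    (hF : F ∈ homogeneousPart (Fin 4) K j) (h2 : gradedPart (ann F) 2 = netV K)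
    (h1 : ∀ h ∈ ann F, h.IsHomogeneous 1 → h = 0) :
    ∃ G ∈ homogeneousPart (Fin 3) K j, ∃ α : K,
      F = inclDP K G + α • powW K j ∧ G ≠ 0 ∧ α ≠ 0 := by
  have hmem : F ∈ perp (idealV K) ⊓ homogeneousPart (Fin 4) K j :=
    ⟨mem_perp_idealV.2 (idealV_le_of_gradedPart h2), hF⟩
  rw [perp_idealV_inf_homogeneousPart hj] at hmem
  obtain ⟨_, ⟨G, hG, rfl⟩, _, hE, rfl⟩ := Submodule.mem_sup.1 hmem
  obtain ⟨α, rfl⟩ := Submodule.mem_span_singleton.1 hE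
  refine ⟨G, hG, α, rfl, ?_, ?_⟩
  · -- otherwise `x ∘ F = 0`
    rintro rfl
    refine X_ne_zero (R := K) (1 : Fin 4) (h1 _ ?_ (isHomogeneous_X K 1))
    have : (X 1 : MvPolynomial (Fin 4) K) = incl K (X 0) :=
      (rename_X (R := K) Fin.succ (0 : Fin 3)).symm
    rw [mem_ann, this, contract_incl_connectedSum]
    simp
  · -- otherwise `w ∘ F = 0`
    rintro rfl
    refine X_ne_zero (R := K) (0 : Fin 4) (h1 _ ?_ (isHomogeneous_X K 0))
    rw [mem_ann, ← pow_one (X 0), contract_pow_connectedSum one_pos hj, zero_smul]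

/-- `multichoose n i` is the number of monomials of degree `i` in `n` variables. -/
theorem eq_zero_of_hilbertFunction_eq_multichoose {n i : ℕ}
    {I : Ideal (MvPolynomial (Fin n) K)} (hI : hilbertFunction I i = n.multichoose i) :
    ∀ h ∈ I, h.IsHomogeneous i → h = 0 := fun _ hhI hh =>
  eq_zero_of_hilbertFunction_eq
    (hI.trans ((finrank_homogeneousSubmodule i).trans (card_degree_eq n i)).symm) hh hhI

end Family

end GorensteinNets

end

open GorensteinNets DividedPower in
theorem theorem3p7 {K : Type*} [Field K] [IsAlgClosed K] (j : ℕ) (hj : 4 ≤ j) (H : ℕ → ℕ)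
    (h0 : H 0 = 1) (h1 : H 1 = 4) (h2 : H 2 = 7) (hsocle : IsGreatest {i | H i ≠ 0} j) :
    -- (i) the inverse system of the ideal `(wx, wy, wz)` in degree `j`
    (perp (idealV K) ⊓ homogeneousPart (Fin 4) K j =
      (homogeneousPart (Fin 3) K j).map (inclDP K) ⊔ Submodule.span K {powW K j}) ∧
    -- (ii) the structure of the algebras `R/I`, with `I` in `ℭ(H)` and `I_2 = ⟨wx, wy, wz⟩`
    (∀ I ∈ familyC K H, gradedPart I 2 = netV K →
      (∃ F ∈ homogeneousPart (Fin 4) K j, I = ann F) ∧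
      ∀ F ∈ homogeneousPart (Fin 4) K j, I = ann F →
        ∃ G ∈ homogeneousPart (Fin 3) K j, ∃ α : K,
          F = inclDP K G + α • powW K j ∧ G ≠ 0 ∧ α ≠ 0 ∧
          -- `J_I = I ∩ K[x,y,z]` is the height three Gorenstein ideal `Ann(G)`
          I.comap (incl K) = ann G ∧
          IsArtinianGorenstein (I.comap (incl K)) ∧
          (I.comap (incl K)).height = 3 ∧
          -- `I = (J_I, wx, wy, wz, w^j - g)`
          (∃ g ∈ homogeneousSubmodule (Fin 3) K j, g ≠ 0 ∧
            I = (I.comap (incl K)).map (incl K) ⊔ idealV K ⊔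
              Ideal.span {MvPolynomial.X 0 ^ j - incl K g}) ∧
          -- the Hilbert function
          (∀ i, hilbertFunction I i =
            hilbertFunction (I.comap (incl K)) i + innerOnes j i) ∧
          hilbertFunction I (j - 1) = 4 ∧ hilbertFunction I j = 1 ∧
          -- the inverse system of `I`
          perp I ⊓ homogeneousPart (Fin 4) K j = Submodule.span K {F} ∧
          (∀ i, j + 1 ≤ i → perp I ⊓ homogeneousPart (Fin 4) K i = ⊥) ∧
          (∀ i, 1 ≤ i → i ≤ j - 1 →
            perp I ⊓ homogeneousPart (Fin 4) K i = orbit F ⊓ homogeneousPart (Fin 4) K i ∧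
            orbit F ⊓ homogeneousPart (Fin 4) K i =
              (orbit G ⊓ homogeneousPart (Fin 3) K i).map (inclDP K) ⊔
                Submodule.span K {powW K i})) ∧
    -- (iii) nonemptiness of `ℭ(H)`
    ((familyC K H).Nonempty ↔
      ∃ H' : ℕ → ℕ, (∀ i, (H' i : ℤ) = (H i : ℤ) - (innerOnes j i : ℤ)) ∧
        IsGorensteinSequence K 3 H') := by
  have hjpos : 0 < j := by omega
  have hlt : ∀ i, j < i → H i = 0 := by
    intro i hi
    by_contra h
    have : i ≤ j := hsocle.2 h
    omega
  have hform : ∀ I ∈ familyC K H, ∃ F ∈ homogeneousPart (Fin 4) K j, I = ann F := by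
    rintro I ⟨hI, hIH, -⟩
    exact hI.exists_eq_ann (by rw [hIH]; exact hsocle.1) (by rw [hIH]; exact hlt)
  have hlin : ∀ I ∈ familyC K H, ∀ h ∈ I, h.IsHomogeneous 1 → h = 0 := by
    rintro I ⟨-, hIH, -⟩
    exact eq_zero_of_hilbertFunction_eq_multichoose (by rw [hIH, h1, Nat.multichoose_one_right])
  refine ⟨perp_idealV_inf_homogeneousPart hjpos, ?_, ?_, ?_⟩
  · intro I hI hI2
    refine ⟨hform I hI, ?_⟩
    rintro F hF rfl
    have hlinF := hlin _ hI
    obtain ⟨G, hG, α, hFG, hG0, hα⟩ := exists_eq_connectedSum hjpos hF hI2 hlinF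
    have hF0 : F ≠ 0 := hFG ▸ connectedSum_ne_zero hjpos hG0
    have hcomap : (ann F).comap (incl K) = ann G := hFG ▸ comap_ann_connectedSum hjpos hG hG0
    have hAG := isArtinianGorenstein_ann hG hG0
    refine ⟨G, hG, α, hFG, hG0, hα, hcomap, hcomap ▸ hAG, ?_, ?_, ?_, ?_, ?_, ?_, ?_, ?_⟩
    · rw [hcomap]
      refine height_of_isArtinianRing_quotient hAG.isArtinianRing ?_
      rw [Ideal.ne_top_iff_one, mem_ann, map_one]
      exact hG0
    · rw [hcomap, hFG]
      exact exists_ann_connectedSum_eq hjpos hG hG0 hα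
    · rw [hcomap, hFG]
      exact hilbertFunction_connectedSum hjpos hG hG0 hα
    · rw [hilbertFunction_ann_sub_one hF hjpos hlinF, finrank_homogeneousPart, card_degree_eq,
        Nat.multichoose_one_right]
    · exact hilbertFunction_ann_self hF hF0
    · rw [perp_ann_inf_homogeneousPart hF, orbit_inf_homogeneousPart hF (add_zero j),
        map_contractL_zero]
    · intro i hi
      exact perp_inf_homogeneousPart_eq_bot fun h hh => contract_eq_zero_of_lt hh hF hi
    · intro i _ hi
      refine ⟨perp_ann_inf_homogeneousPart hF i, ?_⟩
      rw [hFG]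
      exact orbit_connectedSum_inf hG hα (by omega)
  · intro hne
    obtain ⟨I, hI, hI2⟩ := exists_mem_familyC_gradedPart_eq hne
    obtain ⟨F, hF, rfl⟩ := hform I hI
    obtain ⟨G, hG, α, rfl, hG0, hα⟩ := exists_eq_connectedSum hjpos hF hI2 (hlin _ hI)
    have hH : ∀ i, H i = hilbertFunction (ann G) i + innerOnes j i := by
      rw [← hI.2.1]
      exact hilbertFunction_connectedSum hjpos hG hG0 hα
    refine ⟨hilbertFunction (ann G), fun i => ?_, ?_, ann G, isArtinianGorenstein_ann hG hG0, rfl⟩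
    · rw [hH i]
      push_cast
      ring
    · have := hH 1
      rw [h1, innerOnes, if_pos (by omega)] at this
      omega
  · rintro ⟨H', hH', -, J, hJ, rfl⟩
    have hH : ∀ i, H i = hilbertFunction J i + innerOnes j i := fun i => by
      have := hH' i
      omega
    have hJj : hilbertFunction J j ≠ 0 := by
      have h3 : H j ≠ 0 := hsocle.1
      have h4 := hH j
      rw [innerOnes, if_neg (by omega)] at h4
      omega
    obtain ⟨G, hG, rfl⟩ := hJ.exists_eq_ann hJj fun i hi => by
      have h3 := hlt i hi
      have h4 := hH i
      omega
    have hG0 : G ≠ 0 := by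
      rintro rfl
      obtain ⟨h, -, hh⟩ := exists_notMem_of_hilbertFunction_ne_zero hJj
      exact hh (map_zero _)
    have hquad : ∀ p ∈ ann G, p.IsHomogeneous 2 → p = 0 := by
      apply eq_zero_of_hilbertFunction_eq_multichoose
      have h4 := hH 2
      rw [h2, innerOnes, if_pos (by omega)] at h4
      have h5 : Nat.multichoose 3 2 = 6 := by rw [Nat.multichoose_eq]; rfl
      omega
    refine ⟨ann (inclDP K G + (1 : K) • powW K j), isArtinianGorenstein_ann
      (inclDP_add_powW_mem hG) (connectedSum_ne_zero hjpos hG0), ?_, 1, ?_⟩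
    · funext i
      rw [hilbertFunction_connectedSum hjpos hG hG0 one_ne_zero, hH]
    · rw [changeVars_one, gradedPart_two_ann_connectedSum (by omega) one_ne_zero hquad]
      exact Submodule.map_id _
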